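/- **Setting.** Let $I_1,I_2,I_3>0$, $m>0$, $r\in\mathbb R$, $\mathbb I=\operatorname{diag}(I_1,I_2,I_3)$, and let $E$ be the $3\times3$ identity matrix. Let $A$ be a $3\times 3$ matrix of rank $j\in\{0,1,2,3\}$ of the following form: $A=\begin{pmatrix}C&0\\0&1\end{pmatrix}$ with $C\in SO(2)$ if $j=3$; $A=\begin{pmatrix}C&0\\0&0\end{pmatrix}$ with $C\in SO(2)$ if $j=2$; $A=e_3e_3^T$ if $j=1$; $A=0$ if $j=0$. On $Q=SO(3)\times\mathbb R^3\ni(g,x)$ put $\hat\Omega=g^{-1}\dot g$, $\hat\omega=\dot g g^{-1}$ (hat map $\mathbb R^3\cong\mathfrak{so}(3)$), and consider the Lagrangian $\mathcal L=\frac12\,\mathbb I\Omega\cdot\Omega+\frac m2\|\dot x\|^2$ with the constraint distribution $\mathcal D=\{\dot x=rA\omega\}\subset TQ$. Write covectors as $M\cdot\lambda+p\cdot dx$, where $\lambda(\dot g)=\Omega$ is the left Maurer–Cartan form. Let $\mathcal M=\mathrm{Leg}(\mathcal D)\subset T^*Q$ with $\mathrm{Leg}$ the Legendre transform of $\mathcal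 L$, let $\Omega_Q=-d\theta$ be the canonical 2-form ($\theta$ the Liouville 1-form), and let $\mathcal C\subset T\mathcal M$ be the distribution of the vectors tangent to $\mathcal M$ whose projection to $TQ$ lies in $\mathcal D$. The nonholonomic bracket on $C^\infty(\mathcal M)$ is $\{f,g\}_{nh}=\Omega_Q(X_f,X_g)$, where $X_f\in\mathcal C$ is the unique vector field with $\Omega_Q(X_f,Y)=df(Y)$ for all $Y\in\mathcal C$. The group $H=\{(h,y)\in SE(3): he_3=e_3\}$ acts on $Q$ by $(g,x)\mapsto(hg,hx+y)$ and on $T^*Q$ by the cotangent lift. Let $\mathcal R=\mathcal M/H$ with projection $\rho$; a function $f$ on $\mathcal R$ is smooth iff $f\circ\rho$ is. Put $\gamma=g^{-1}e_3$ and $K=M+rg^TA^Tp$ (on $\mathcal M$ this is $K=\mathbb I\Omega+mr^2g^TA^TAg\,\Omega$). For functions on $\mathbb R^3\times\mathbb R^3\ni(\gamma,K)$ let $$\{F,G\}_{\mathrm{Rank}\,j}=-V_j\cdot\Big(\frac{\partial F}{\partial K}\times\frac{\partial G}{\partial K}\Big)-\gamma\cdot\Big(\frac{\partial F}{\partial K}\times\frac{\partial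 G}{\partial\gamma}-\frac{\partial G}{\partial K}\times\frac{\partial F}{\partial\gamma}\Big),$$ where, with $J=\mathbb I+mr^2E$, - $j=0$: $V_0=K$; - $j=1$: $V_1=K+mr^2(\Omega\cdot\gamma)\gamma$, with $\Omega=\mathbb I^{-1}K-mr^2\,\dfrac{K\cdot\mathbb I^{-1}\gamma}{\|\gamma\|^2+mr^2\,\gamma\cdot\mathbb I^{-1}\gamma}\,\mathbb I^{-1}\gamma$; - $j=2$: $V_2=K+mr^2\Omega-mr^2(\Omega\cdot\gamma)\gamma$, with $\Omega=J^{-1}K+mr^2\,\dfrac{K\cdot J^{-1}\gamma}{\|\gamma\|^2-mr^2\,\gamma\cdot J^{-1}\gamma}\,J^{-1}\gamma$; - $j=3$: $V_3=K+mr^2\Omega$, with $\Omega=J^{-1}K$. **Theorem.** The bracket $\{\cdot,\cdot\}_{nh}$ is well defined (each $X_f$ exists and is unique at every point), the action of $H$ leaves $\mathcal M$ invariant, and the bracket descends to a bracket $\{\cdot,\cdot\}_{red}$ on $C^\infty(\mathcal R)$, characterized by $\{f,g\}_{red}\circ\rho=\{f\circ\rho,g\circ\rho\}_{nh}$. The function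 $\|\gamma\|^2$ is a Casimir function of $\{\cdot,\cdot\}_{\mathrm{Rank}\,j}$. The map $(\gamma,K)$ induces a diffeomorphism $\Phi$ of $\mathcal R$ onto the level set $\{\|\gamma\|=1\}=S^2\times\mathbb R^3$, and under this identification $\{\cdot,\cdot\}_{red}$ is the restriction of $\{\cdot,\cdot\}_{\mathrm{Rank}\,j}$ to that level set: for all $f,g\in C^\infty(\mathcal R)$, every $x\in\mathcal R$, and all smooth extensions $F,G$ of $f\circ\Phi^{-1},g\circ\Phi^{-1}$ to a neighbourhood of $\Phi(x)$ in $\mathbb R^3\times\mathbb R^3$, $$\{f,g\}_{red}(x)=\{F,G\}_{\mathrm{Rank}\,j}(\Phi(x)).$$ -/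

import Mathlib

open scoped Matrix ContDiff

noncomputable section

namespace RollingBody

/-! ### Embedded submanifolds of a normed space -/

section Submanifold

variable {V : Type*} [NormedAddCommGroup V] [NormedSpace ℝ V] {S : Set V}

/-- `F` is a smooth extension of `f : S → ℝ` to an open neighbourhood of the point `x`. -/
def LocallyExtends (F : V → ℝ) (f : S → ℝ) (x : V) : Prop :=
  ∃ U : Set V, IsOpen U ∧ x ∈ U ∧ ContDiffOn ℝ ∞ F U ∧ ∀ y : S, (y : V) ∈ U → F y = f y

/-- `f ∈ C^∞(S)`, for `S` an embedded submanifold of a normed space. -/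
def SmoothFun (f : S → ℝ) : Prop :=
  ∀ x : S, ∃ F : V → ℝ, LocallyExtends F f x

/-- `c` is a smooth curve in `S` with `c(0) = x` and `c'(0) = v`. -/
def IsCurveThrough (c : ℝ → S) (x v : V) : Prop :=
  ContDiff ℝ ∞ (fun t => (c t : V)) ∧ (c 0 : V) = x ∧ deriv (fun t => (c t : V)) 0 = v

variable (S) in
/-- The tangent space `T_x S`, as the set of velocities of smooth curves in `S` through `x`. -/
def tangentVectors (x : V) : Set V :=
  {v | ∃ c : ℝ → S, IsCurveThrough c x v}

end Submanifold

/-! ### The configuration space `Q = SO(3) × ℝ³` and its cotangent bundle -/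

abbrev R3 : Type := Fin 3 → ℝ

abbrev Mat3 : Type := Matrix (Fin 3) (Fin 3) ℝ

/-- Ambient space of `Q`. Elements are `(g, x)`; as tangent vectors they are `(ġ, ẋ)`. The matrix
component is stored as a function `Fin 3 → Fin 3 → ℝ`, which carries a norm, and is read as a matrix
through `Matrix.of`. (The sup norm serves only to have the finite-dimensional topology and calculus
at hand; Euclidean quantities are always expressed with the dot product `⬝ᵥ`.) -/
abbrev Conf : Type := (Fin 3 → Fin 3 → ℝ) × R3

/-- Ambient space of `T*Q`. Elements are `(g, x, M, p)`, with `g` stored as in `Conf`. -/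
abbrev Phase : Type := (Fin 3 → Fin 3 → ℝ) × R3 × R3 × R3

/-- The third canonical vector. -/
def e3 : R3 := ![0, 0, 1]

/-- The hat map `ℝ³ → so(3)`. -/
def hat (η : R3) : Mat3 :=
  !![0, -η 2, η 1; η 2, 0, -η 0; -η 1, η 0, 0]

/-- The inverse of the hat map on skew-symmetric matrices, extended to all matrices by first taking
the skew-symmetric part. -/
def vee : Mat3 →ₗ[ℝ] R3 where
  toFun B := ![(B 2 1 - B 1 2) / 2, (B 0 2 - B 2 0) / 2, (B 1 0 - B 0 1) / 2]
  map_add' B C := by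
    ext i; fin_cases i <;> simp <;> ring
  map_smul' a B := by
    ext i; fin_cases i <;> simp <;> ring

theorem vee_hat (η : R3) : vee (hat η) = η := by
  ext i; fin_cases i <;> simp [vee, hat]

/-- The configuration space `SO(3) × ℝ³`. -/
def Q : Set Conf := {q | Matrix.of q.1 ∈ Matrix.specialOrthogonalGroup (Fin 3) ℝ}

/-- Angular velocity in body coordinates: `hat Ω = g⁻¹ ġ` (and `g⁻¹ = gᵀ` on `SO(3)`). As a one-form
this is the left Maurer-Cartan form `λ`. -/
def bodyAngVel (g : Mat3) : Mat3 →ₗ[ℝ] R3 where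
  toFun v := vee (gᵀ * v)
  map_add' v w := by rw [mul_add, map_add]
  map_smul' a v := by rw [Matrix.mul_smul, map_smul]; rfl

/-- Angular velocity in space coordinates: `hat ω = ġ g⁻¹`. -/
def spaceAngVel (g v : Mat3) : R3 := vee (v * gᵀ)

/-- The cotangent bundle `T*Q`. In the global coframe `{λ, dx}` of `Q` a covector at `(g, x)` is
written uniquely as `M · λ + p · dx` and is represented by `(g, x, M, p)`. -/
def cotangentBundle : Set Phase := {z | Matrix.of z.1 ∈ Matrix.specialOrthogonalGroup (Fin 3) ℝ}

/-- The bundle projection `τ : T*Q → Q`; it is linear in the ambient coordinates. -/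
def proj : Phase →ₗ[ℝ] Conf where
  toFun z := (z.1, z.2.1)
  map_add' _ _ := rfl
  map_smul' _ _ := rfl

/-- The covector `M · λ + p · dx` represented by `z = (g, x, M, p)`, as a linear form. -/
def covector (z : Phase) : Conf →ₗ[ℝ] ℝ where
  toFun w := z.2.2.1 ⬝ᵥ bodyAngVel (Matrix.of z.1) (Matrix.of w.1) + z.2.2.2 ⬝ᵥ w.2
  map_add' v w := by
    simp only [Prod.fst_add, Prod.snd_add, ← Matrix.of_add_of, map_add, dotProduct_add]; ring
  map_smul' a v := by
    simp only [Prod.smul_fst, Prod.smul_snd, ← Matrix.smul_of, map_smul, dotProduct_smul,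
      RingHom.id_apply, smul_add]

theorem contDiff_covector (Y : Conf) : ContDiff ℝ ∞ (fun z : Phase => covector z Y) := by
  have e : (fun z : Phase => covector z Y) = fun z : Phase =>
      (∑ i, z.2.2.1 i * bodyAngVel (Matrix.of z.1) (Matrix.of Y.1) i)
        + ∑ i, z.2.2.2 i * Y.2 i := rfl
  have hv : ∀ i, ContDiff ℝ ∞
      (fun z : Phase => bodyAngVel (Matrix.of z.1) (Matrix.of Y.1) i) := by
    intro i
    fin_cases i <;>
    · simp [bodyAngVel, vee, Matrix.mul_apply, Fin.sum_univ_three]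
      fun_prop
  rw [e]
  fun_prop

/-- The Liouville one-form `θ_z(Z) = z(dτ Z)` on `T*Q`, given by the same formula on the ambient
space. -/
def liouville (z : Phase) : Phase [⋀^Fin 1]→L[ℝ] ℝ :=
  ContinuousAlternatingMap.ofSubsingleton ℝ Phase ℝ 0
    (LinearMap.toContinuousLinearMap (covector z ∘ₗ proj))

/-- The canonical symplectic form `Ω_Q = -dθ` of `T*Q`, evaluated at `z` on `X, Y ∈ T_z(T*Q)`.
(Pulling back to the submanifold `T*Q` commutes with the exterior derivative.) -/
def canonicalForm (z X Y : Phase) : ℝ := -(extDeriv liouville z ![X, Y])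

theorem differentiable_liouville : Differentiable ℝ liouville := by
  have h : ContDiff ℝ ∞
      (fun z : Phase => LinearMap.toContinuousLinearMap (covector z ∘ₗ proj)) :=
    contDiff_clm_apply_iff.2 fun Y => contDiff_covector (proj Y)
  let e : (Phase →L[ℝ] ℝ) ≃ₗᵢ[ℝ] (Phase [⋀^Fin 1]→L[ℝ] ℝ) :=
    ContinuousAlternatingMap.ofSubsingletonLIE 0
  exact e.toContinuousLinearEquiv.differentiable.comp (h.differentiable (by simp))

/-- `dθ(X, Y) = X(θ(Y)) - Y(θ(X))` for constant vector fields. -/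
theorem canonicalForm_eq (z X Y : Phase) : canonicalForm z X Y =
    fderiv ℝ (fun z' => covector z' (proj X)) z Y
      - fderiv ℝ (fun z' => covector z' (proj Y)) z X := by
  have e0 : (Fin.removeNth 0 ![X, Y] : Fin 1 → Phase) = ![Y] := by
    funext i; fin_cases i; rfl
  have e1 : (Fin.removeNth 1 ![X, Y] : Fin 1 → Phase) = ![X] := by
    funext i; fin_cases i; rfl
  rw [canonicalForm, extDeriv_apply (differentiable_liouville z), Fin.sum_univ_two, e0, e1]
  change -((-1) ^ 0 • fderiv ℝ (fun z' => covector z' (proj Y)) z X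
    + (-1) ^ 1 • fderiv ℝ (fun z' => covector z' (proj X)) z Y) = _
  simp [sub_eq_add_neg]

/-! ### The nonholonomic system -/

/-- A matrix that defines a generalized rolling constraint. -/
def IsGeneralizedRolling (A : Mat3) : Prop :=
  (A.rank = 3 ∧ ∃ C ∈ Matrix.specialOrthogonalGroup (Fin 2) ℝ,
    A = !![C 0 0, C 0 1, 0; C 1 0, C 1 1, 0; 0, 0, 1]) ∨
  (A.rank = 2 ∧ ∃ C ∈ Matrix.specialOrthogonalGroup (Fin 2) ℝ,
    A = !![C 0 0, C 0 1, 0; C 1 0, C 1 1, 0; 0, 0, 0]) ∨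
  (A.rank = 1 ∧ A = Matrix.vecMulVec e3 e3) ∨
  (A.rank = 0 ∧ A = 0)

/-- Data of the system: principal moments of inertia, mass, length scale `r`, and the matrix `A` of
the constraint `ẋ = r A ω`. -/
structure Body where
  inertia : R3
  mass : ℝ
  r : ℝ
  A : Mat3

namespace Body

variable (B : Body)

/-- The inertia tensor `𝕀`. -/
def inertiaTensor : Mat3 := Matrix.diagonal B.inertia

/-- The kinetic energy Lagrangian `½ 𝕀Ω · Ω + (m/2) ‖ẋ‖²` on `TQ`. -/
def lagrangian (q w : Conf) : ℝ :=
  let Ω := bodyAngVel (Matrix.of q.1) (Matrix.of w.1)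
  (1 / 2) * ((B.inertiaTensor *ᵥ Ω) ⬝ᵥ Ω) + (B.mass / 2) * (w.2 ⬝ᵥ w.2)

/-- The fibre of the constraint distribution `D ⊂ TQ` over `q`: `ẋ = r A ω`. -/
def constraintDistribution (q : Conf) : Set Conf :=
  {w | w ∈ tangentVectors Q q ∧
    w.2 = B.r • (B.A *ᵥ spaceAngVel (Matrix.of q.1) (Matrix.of w.1))}

/-- `z ∈ T*Q` is the image of `w ∈ T_qQ`, `q = τ(z)`, under the Legendre transform, the fibre
derivative of the Lagrangian. -/
def IsLegendre (z : Phase) (w : Conf) : Prop :=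
  ∀ u ∈ tangentVectors Q (proj z),
    covector z u = deriv (fun s : ℝ => B.lagrangian (proj z) (w + s • u)) 0

/-- The constraint space `𝓜 = Leg(D) ⊂ T*Q`. -/
def constraintSpace : Set Phase :=
  {z | z ∈ cotangentBundle ∧ ∃ w ∈ B.constraintDistribution (proj z), B.IsLegendre z w}

/-- The distribution `𝓒 = T𝓜 ∩ 𝓕` on `𝓜`, where `𝓕` consists of the vectors tangent to `T*Q` that
project to `D`. -/
def distributionC (z : Phase) : Set Phase :=
  {Z | Z ∈ tangentVectors B.constraintSpace z ∧ proj Z ∈ B.constraintDistribution (proj z)}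

/-- `X` is the value at `z ∈ 𝓜` of the almost Hamiltonian vector field of `f : 𝓜 → ℝ`: `X ∈ 𝓒_z` and
`Ω_Q(X, Y) = df(Y)` for all `Y ∈ 𝓒_z`, where `df(c'(0)) = (f ∘ c)'(0)`. -/
def IsHamVec (f : B.constraintSpace → ℝ) (z : B.constraintSpace) (X : Phase) : Prop :=
  X ∈ B.distributionC z ∧
    ∀ Y ∈ B.distributionC z, ∀ c : ℝ → B.constraintSpace, IsCurveThrough c (z : Phase) Y →
      canonicalForm z X Y = deriv (fun t => f (c t)) 0

/-- The almost Hamiltonian vector field `X_f`. -/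
def hamVec (f : B.constraintSpace → ℝ) (z : B.constraintSpace) : Phase :=
  Classical.epsilon (B.IsHamVec f z)

/-- The nonholonomic bracket `{f, g}_nh = Ω_𝓒(X_f, X_g)`. -/
def nhBracket (f g : B.constraintSpace → ℝ) (z : B.constraintSpace) : ℝ :=
  canonicalForm z (B.hamVec f z) (B.hamVec g z)

end Body

/-! ### Symmetries and reduction -/

/-- The Euclidean group `SE(3)`. -/
@[ext]
structure SE3 where
  rot : Matrix.specialOrthogonalGroup (Fin 3) ℝ
  trans : R3

namespace SE3

instance : Mul SE3 := ⟨fun a b => ⟨a.rot * b.rot, (a.rot : Mat3) *ᵥ b.trans + a.trans⟩⟩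

instance : One SE3 := ⟨⟨1, 0⟩⟩

instance : Inv SE3 := ⟨fun a => ⟨a.rot⁻¹, -(((a.rot⁻¹ : _) : Mat3) *ᵥ a.trans)⟩⟩

theorem mul_def (a b : SE3) :
    a * b = ⟨a.rot * b.rot, (a.rot : Mat3) *ᵥ b.trans + a.trans⟩ := rfl

theorem one_def : (1 : SE3) = ⟨1, 0⟩ := rfl

theorem inv_def (a : SE3) :
    a⁻¹ = ⟨a.rot⁻¹, -(((a.rot⁻¹ : _) : Mat3) *ᵥ a.trans)⟩ := rfl

instance : Group SE3 :=
  Group.ofLeftAxioms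
    (by
      intro a b c
      ext1
      · simp [mul_def, mul_assoc]
      · simp [mul_def, Matrix.mulVec_add, Matrix.mulVec_mulVec, add_assoc])
    (by
      intro a
      ext1 <;> simp [mul_def, one_def])
    (by
      intro a
      ext1 <;> simp [mul_def, one_def, inv_def])

/-- Tangent map of left translation `(g, x) ↦ (h g, h x + y)` of `Q`. -/
def tangentLift (a : SE3) (w : Conf) : Conf :=
  (Matrix.of.symm ((a.rot : Mat3) * Matrix.of w.1), (a.rot : Mat3) *ᵥ w.2)

/-- Cotangent lift to `T*Q` of left translation `(g, x) ↦ (h g, h x + y)` of `Q`. -/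
def cotangentLift (a : SE3) (z : Phase) : Phase :=
  (Matrix.of.symm ((a.rot : Mat3) * Matrix.of z.1), (a.rot : Mat3) *ᵥ z.2.1 + a.trans,
    z.2.2.1, (a.rot : Mat3) *ᵥ z.2.2.2)

theorem transpose_mul_rot (a : SE3) : (a.rot : Mat3)ᵀ * (a.rot : Mat3) = 1 := by
  have h := (Matrix.mem_specialOrthogonalGroup_iff.1 a.rot.2).1
  exact (Matrix.mem_orthogonalGroup_iff' (Fin 3) ℝ).1 h

/-- The defining property of the cotangent lift: it is the inverse transpose of the tangent map. -/
theorem covector_cotangentLift (a : SE3) (z : Phase) (w : Conf) :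
    covector (a.cotangentLift z) (a.tangentLift w) = covector z w := by
  have h := a.transpose_mul_rot
  have h1 : ((a.rot : Mat3) * Matrix.of z.1)ᵀ * ((a.rot : Mat3) * Matrix.of w.1)
      = (Matrix.of z.1)ᵀ * Matrix.of w.1 := by
    rw [Matrix.transpose_mul, Matrix.mul_assoc, ← Matrix.mul_assoc _ _ (Matrix.of w.1), h,
      Matrix.one_mul]
  have h2 : ((a.rot : Mat3) *ᵥ z.2.2.2) ⬝ᵥ ((a.rot : Mat3) *ᵥ w.2) = z.2.2.2 ⬝ᵥ w.2 := by
    rw [Matrix.dotProduct_mulVec, ← Matrix.mulVec_transpose, Matrix.mulVec_mulVec, h,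
      Matrix.one_mulVec]
  simp only [covector, cotangentLift, tangentLift, bodyAngVel, LinearMap.coe_mk, AddHom.coe_mk,
    Equiv.apply_symm_apply, h1, h2]

theorem cotangentLift_mul (a b : SE3) (z : Phase) :
    (a * b).cotangentLift z = a.cotangentLift (b.cotangentLift z) := by
  simp [cotangentLift, mul_def, Matrix.mul_assoc, Matrix.mulVec_add, Matrix.mulVec_mulVec,
    add_assoc]

theorem cotangentLift_one (z : Phase) : (1 : SE3).cotangentLift z = z := by
  simp [cotangentLift, one_def]

end SE3

/-- The symmetry group `H = {(h, y) ∈ SE(3) : h e₃ = e₃}`. -/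
def symmetryGroup : Subgroup SE3 where
  carrier := {a | (a.rot : Mat3) *ᵥ e3 = e3}
  mul_mem' {a b} ha hb := by
    simp only [Set.mem_ofPred_eq] at *
    simp only [SE3.mul_def, Submonoid.coe_mul]
    rw [← Matrix.mulVec_mulVec, hb, ha]
  one_mem' := by simp [SE3.one_def]
  inv_mem' {a} ha := by
    simp only [Set.mem_ofPred_eq] at *
    have h : ((a⁻¹ * a : SE3).rot : Mat3) *ᵥ e3 = e3 := by
      rw [inv_mul_cancel]; simp [SE3.one_def]
    simp only [SE3.mul_def, Submonoid.coe_mul] at h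
    rw [← Matrix.mulVec_mulVec, ha] at h
    exact h

namespace Body

variable (B : Body)

/-- Two points of `𝓜` are equivalent when they lie on the same orbit of the lifted action of `H`. -/
def orbitSetoid : Setoid B.constraintSpace where
  r z z' := ∃ a ∈ symmetryGroup, a.cotangentLift z = z'
  iseqv :=
    { refl := fun z => ⟨1, symmetryGroup.one_mem, SE3.cotangentLift_one _⟩
      symm := by
        rintro z z' ⟨a, ha, h⟩
        refine ⟨a⁻¹, symmetryGroup.inv_mem ha, ?_⟩
        rw [← h, ← SE3.cotangentLift_mul, inv_mul_cancel, SE3.cotangentLift_one]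
      trans := by
        rintro z z' z'' ⟨a, ha, h⟩ ⟨b, hb, h'⟩
        refine ⟨b * a, symmetryGroup.mul_mem hb ha, ?_⟩
        rw [SE3.cotangentLift_mul, h, h'] }

/-- The reduced space `𝓡 = 𝓜 / H`. -/
def ReducedSpace : Type := Quotient B.orbitSetoid

/-- The orbit projection `ρ : 𝓜 → 𝓡`. -/
def orbitProj (z : B.constraintSpace) : B.ReducedSpace := Quotient.mk B.orbitSetoid z

/-- `f ∈ C^∞(𝓡)`. As `ρ` is a surjective submersion, this means `f ∘ ρ ∈ C^∞(𝓜)`. -/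
def SmoothRed (f : B.ReducedSpace → ℝ) : Prop := SmoothFun (f ∘ B.orbitProj)

/-- The reduced bracket `{f, g}_red`, computed at an arbitrary point of the orbit. -/
def redBracket (f g : B.ReducedSpace → ℝ) (x : B.ReducedSpace) : ℝ :=
  B.nhBracket (f ∘ B.orbitProj) (g ∘ B.orbitProj) (Quotient.out x)

/-- The Poisson vector `γ = g⁻¹ e₃`. -/
def poissonVector (z : Phase) : R3 := (Matrix.of z.1)ᵀ *ᵥ e3

/-- The kinetic momentum `K = M + r gᵀ Aᵀ p`: the coefficient of `λ` of a covector in the coframe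
`{λ, ε}`, with `ε = dx - r A g λ` the constraint form. -/
def kineticMomentum (z : Phase) : R3 :=
  z.2.2.1 + B.r • ((Matrix.of z.1)ᵀ *ᵥ (B.Aᵀ *ᵥ z.2.2.2))

/-! ### The explicit brackets on `ℝ³ × ℝ³`, with coordinates `(γ, K)` -/

/-- `𝕀 + m r² E`. -/
def totalInertia : Mat3 := B.inertiaTensor + (B.mass * B.r ^ 2) • (1 : Mat3)

/-- The angular velocity `Ω` as a function of `(γ, K)` when `A` has rank `j`. -/
def angVel (j : ℕ) (γ K : R3) : R3 :=
  let μ := B.mass * B.r ^ 2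
  match j with
  | 0 => B.inertiaTensor⁻¹ *ᵥ K
  | 1 => B.inertiaTensor⁻¹ *ᵥ K
      - (μ * ((K ⬝ᵥ (B.inertiaTensor⁻¹ *ᵥ γ)) /
          (γ ⬝ᵥ γ + μ * (γ ⬝ᵥ (B.inertiaTensor⁻¹ *ᵥ γ))))) • (B.inertiaTensor⁻¹ *ᵥ γ)
  | 2 => B.totalInertia⁻¹ *ᵥ K
      + (μ * ((K ⬝ᵥ (B.totalInertia⁻¹ *ᵥ γ)) /
          (γ ⬝ᵥ γ - μ * (γ ⬝ᵥ (B.totalInertia⁻¹ *ᵥ γ))))) • (B.totalInertia⁻¹ *ᵥ γ)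
  | _ => B.totalInertia⁻¹ *ᵥ K

/-- The vector that multiplies `-(∂f/∂K × ∂g/∂K)` in the bracket of rank `j`. -/
def bracketVector (j : ℕ) (γ K : R3) : R3 :=
  let μ := B.mass * B.r ^ 2
  let Ω := B.angVel j γ K
  match j with
  | 0 => K
  | 1 => K + (μ * (Ω ⬝ᵥ γ)) • γ
  | 2 => K + μ • Ω - (μ * (Ω ⬝ᵥ γ)) • γ
  | _ => K + μ • Ω

end Body

/-- `∂F/∂γ` at `y = (γ, K)`. -/
def gradγ (F : R3 × R3 → ℝ) (y : R3 × R3) : R3 := fun i => fderiv ℝ F y (Pi.single i 1, 0)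

/-- `∂F/∂K` at `y = (γ, K)`. -/
def gradK (F : R3 × R3 → ℝ) (y : R3 × R3) : R3 := fun i => fderiv ℝ F y (0, Pi.single i 1)

/-- The bracket `{F, G}_{Rank j}` at `y = (γ, K)`. -/
def Body.rankBracket (B : Body) (j : ℕ) (F G : R3 × R3 → ℝ) (y : R3 × R3) : ℝ :=
  -(B.bracketVector j y.1 y.2 ⬝ᵥ (gradK F y ⨯₃ gradK G y))
    - y.1 ⬝ᵥ (gradK F y ⨯₃ gradγ G y - gradK G y ⨯₃ gradγ F y)

/-- The level set `‖γ‖ = 1`, that is `S² × ℝ³`. -/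
def levelSet : Set (R3 × R3) := {y | y.1 ⬝ᵥ y.1 = 1}

end RollingBody

end

open RollingBody

noncomputable section

namespace RollingBody

/-! ### Linear algebra in `ℝ³` -/

/-! On `𝓜` the Legendre transform gives `Ω = 𝕀⁻¹M` and `p = m r A g Ω`, so `𝓜` is a graph over `(g,
x, M)` (`mem_constraintSpace_iff`). A vector of `𝓒` is then determined by its body angular velocity
`ξ` and the velocity `κ` of `K`, and both are arbitrary (`mem_distributionC_iff_hamLift`).

Write `θ = K · λ + p · ε` with `ε = dx - r A ω`. On `𝓒` the form `ε` vanishes but `dε` does not, and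
the Maurer-Cartan equations give `Ω_Q = κ' · ξ - κ · ξ' + V · (ξ × ξ')` with `V = K + m r² gᵀAᵀAg
Ω`. This is nondegenerate whatever `V` is, so `X_f` exists and is unique. As `(γ, K)` moves with
velocity `(γ × ξ, κ)`, inserting the Hamiltonian vectors of functions of `(γ, K)` yields the
explicit bracket (`nhBracket_eq`).

The four ranks are treated at once: `AᵀA = a E + b e₃e₃ᵀ`, hence `gᵀAᵀAg = a E + b γγᵀ`, with `(a,
b)` equal to `(1, 0)`, `(1, -1)`, `(0, 1)`, `(0, 0)` for `j = 3, 2, 1, 0`. So `K` is a rank-one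
perturbation of a diagonal matrix applied to `Ω`, inverted by the Sherman-Morrison formula.

For the reduction, `A` commutes with rotations about `e₃`, so `H` preserves `𝓜`; `(γ, K)` separates
the orbits (`toLevelSet_eq_iff`), and smooth local sections of this map (`levelSection`) carry
smooth functions from `𝓡` to the level set. -/

theorem dot_three (u v : R3) : u ⬝ᵥ v = u 0 * v 0 + u 1 * v 1 + u 2 * v 2 := by
  simp [dotProduct, Fin.sum_univ_three]

theorem mulVec_three (A : Mat3) (v : R3) (i : Fin 3) :
    (A *ᵥ v) i = A i 0 * v 0 + A i 1 * v 1 + A i 2 * v 2 := dot_three _ _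

theorem hat_mulVec (ξ v : R3) : hat ξ *ᵥ v = ξ ⨯₃ v := by
  rw [cross_apply]
  ext i; fin_cases i <;> simp [hat, mulVec_three] <;> ring

theorem hat_transpose (ξ : R3) : (hat ξ)ᵀ = -hat ξ := by
  ext i j; fin_cases i <;> fin_cases j <;> simp [hat]

/-- A skew-symmetric matrix is the hat of its vee. -/
theorem hat_vee {S : Mat3} (h : Sᵀ = -S) : hat (vee S) = S := by
  have e : ∀ i j, S j i = -S i j := fun i j => congrFun (congrFun h i) j
  have e00 := e 0 0
  have e11 := e 1 1
  have e22 := e 2 2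
  have e01 := e 0 1
  have e02 := e 0 2
  have e12 := e 1 2
  ext i j
  fin_cases i <;> fin_cases j <;> simp [hat, vee] <;> linarith

theorem mem_SO3_iff {g : Mat3} :
    g ∈ Matrix.specialOrthogonalGroup (Fin 3) ℝ ↔ gᵀ * g = 1 ∧ g.det = 1 := by
  rw [Matrix.mem_specialOrthogonalGroup_iff, Matrix.mem_orthogonalGroup_iff']

theorem transpose_mul_self_of_mem {g : Mat3} (hg : g ∈ Matrix.specialOrthogonalGroup (Fin 3) ℝ) :
    gᵀ * g = 1 := (mem_SO3_iff.1 hg).1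

theorem mul_transpose_self_of_mem {g : Mat3} (hg : g ∈ Matrix.specialOrthogonalGroup (Fin 3) ℝ) :
    g * gᵀ = 1 := mul_eq_one_comm.1 (transpose_mul_self_of_mem hg)

/-- Conjugation by a rotation acts on angular velocities by the rotation. -/
theorem conj_hat {g : Mat3} (hg : g ∈ Matrix.specialOrthogonalGroup (Fin 3) ℝ) (ξ : R3) :
    vee (g * hat ξ * gᵀ) = g *ᵥ ξ := by
  obtain ⟨h1, h2⟩ := mem_SO3_iff.1 hg
  -- The entries of a rotation equal its cofactors, which is the identity `g (u × v) = g u × g v` in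
  -- coordinates.
  have hadj : g.adjugate = gᵀ := by
    calc g.adjugate = (gᵀ * g) * g.adjugate := by rw [h1, one_mul]
      _ = gᵀ := by rw [mul_assoc, Matrix.mul_adjugate, h2, one_smul, mul_one]
  have e : ∀ i j, g.adjugate i j = g j i := fun i j => congrFun (congrFun hadj i) j
  simp only [Matrix.adjugate_fin_three, Matrix.of_apply] at e
  have e00 := e 0 0
  have e01 := e 0 1
  have e02 := e 0 2
  have e10 := e 1 0
  have e11 := e 1 1
  have e12 := e 1 2
  have e20 := e 2 0
  have e21 := e 2 1
  have e22 := e 2 2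
  simp at e00 e01 e02 e10 e11 e12 e20 e21 e22
  ext i
  fin_cases i <;>
    simp [vee, hat, Matrix.mul_apply, Fin.sum_univ_three, mulVec_three]
  · linear_combination ξ 0 * e00 + ξ 1 * e10 + ξ 2 * e20
  · linear_combination ξ 0 * e01 + ξ 1 * e11 + ξ 2 * e21
  · linear_combination ξ 0 * e02 + ξ 1 * e12 + ξ 2 * e22

/-- The Cayley curve of rotations with velocity `hat ξ` at `t = 0`. -/
def cayley (ξ : R3) (t : ℝ) : Mat3 :=
  1 + (1 + t ^ 2 / 4 * (ξ ⬝ᵥ ξ))⁻¹ • (t • hat ξ + (t ^ 2 / 2) • (hat ξ * hat ξ))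

theorem cayley_den_pos (ξ : R3) (t : ℝ) : 0 < 1 + t ^ 2 / 4 * (ξ ⬝ᵥ ξ) := by
  rw [dot_three]
  have : 0 ≤ ξ 0 * ξ 0 + ξ 1 * ξ 1 + ξ 2 * ξ 2 := by
    linarith [mul_self_nonneg (ξ 0), mul_self_nonneg (ξ 1), mul_self_nonneg (ξ 2)]
  positivity

/-- Cayley-Hamilton for a skew matrix, whose trace and determinant vanish. -/
theorem hat_cube (ξ : R3) : hat ξ * hat ξ * hat ξ = -(ξ ⬝ᵥ ξ) • hat ξ := by
  ext i j
  fin_cases i <;> fin_cases j <;>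
    simp [hat, Matrix.mul_apply, Fin.sum_univ_three, dot_three] <;> ring

/-- The curve is the Cayley transform `(1 - (t/2) hat ξ)⁻¹ (1 + (t/2) hat ξ)` with the inverse
expanded by the cubic relation for `hat ξ`. It is rational in `t`, so membership is plain algebra.
-/
theorem cayley_mem (ξ : R3) (t : ℝ) :
    cayley ξ t ∈ Matrix.specialOrthogonalGroup (Fin 3) ℝ := by
  have hd := (cayley_den_pos ξ t).ne'
  set d := 1 + t ^ 2 / 4 * (ξ ⬝ᵥ ξ) with hdef
  have hdot := hdef
  rw [dot_three] at hdot
  clear_value d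
  rw [mem_SO3_iff]
  constructor
  · have h4 : hat ξ * hat ξ * (hat ξ * hat ξ) = -(ξ ⬝ᵥ ξ) • (hat ξ * hat ξ) := by
      rw [← mul_assoc, hat_cube, Matrix.smul_mul]
    have h3 : hat ξ * (hat ξ * hat ξ) = -(ξ ⬝ᵥ ξ) • hat ξ := by rw [← mul_assoc, hat_cube]
    have h2 : d⁻¹ * d = 1 := inv_mul_cancel₀ hd
    rw [cayley, ← hdef]
    simp only [Matrix.transpose_add, Matrix.transpose_one, Matrix.transpose_smul,
      Matrix.transpose_mul, hat_transpose, add_mul, mul_add, one_mul, mul_one,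
      Matrix.smul_mul, Matrix.mul_smul, smul_add, neg_mul, mul_neg, smul_neg, h4, h3, hat_cube,
      smul_smul]
    ext i j
    simp only [Matrix.add_apply, Matrix.neg_apply, Matrix.smul_apply, smul_eq_mul]
    -- Only a multiple of `(hat ξ)²` survives; its coefficient `t²/d - t² (1 + t² ‖ξ‖²/4)/d²`
    -- vanishes by the choice of `d`.
    linear_combination (-(d⁻¹ * t ^ 2 * (hat ξ * hat ξ) i j)) * h2
      + (d⁻¹ ^ 2 * t ^ 2 * (hat ξ * hat ξ) i j) * hdef
  · have : (cayley ξ t).det = (d ^ 2)⁻¹ * d ^ 2 := by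
      rw [cayley, ← hdef, Matrix.det_fin_three]
      simp [hat]
      field_simp
      rw [hdot]
      ring
    rw [this, inv_mul_cancel₀ (pow_ne_zero 2 hd)]

theorem cayley_zero (ξ : R3) : cayley ξ 0 = 1 := by simp [cayley]

theorem contDiff_cayley (ξ : R3) (i j : Fin 3) : ContDiff ℝ ∞ (fun t => cayley ξ t i j) := by
  simp only [cayley, Matrix.add_apply, Matrix.smul_apply, smul_eq_mul]
  have h : ContDiff ℝ ∞ fun t : ℝ => (1 + t ^ 2 / 4 * (ξ ⬝ᵥ ξ))⁻¹ :=
    ContDiff.inv (by fun_prop) fun t => (cayley_den_pos ξ t).ne'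
  fun_prop

theorem hasDerivAt_cayley (ξ : R3) (i j : Fin 3) :
    HasDerivAt (fun t => cayley ξ t i j) (hat ξ i j) 0 := by
  simp only [cayley, Matrix.add_apply, Matrix.smul_apply, smul_eq_mul]
  have h1 : HasDerivAt (fun t : ℝ => 1 + t ^ 2 / 4 * (ξ ⬝ᵥ ξ)) 0 0 := by
    have := (((hasDerivAt_id (0:ℝ)).fun_pow 2).div_const 4).mul_const (ξ ⬝ᵥ ξ)
    simpa using this.const_add 1
  have h2 : HasDerivAt (fun t : ℝ => (1 + t ^ 2 / 4 * (ξ ⬝ᵥ ξ))⁻¹) 0 0 := by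
    simpa using h1.fun_inv (cayley_den_pos ξ 0).ne'
  have h3 : HasDerivAt (fun t : ℝ => t * hat ξ i j + t ^ 2 / 2 * (hat ξ * hat ξ) i j)
      (hat ξ i j) 0 := by
    have a := (hasDerivAt_id (0:ℝ)).mul_const (hat ξ i j)
    have b := (((hasDerivAt_id (0:ℝ)).fun_pow 2).div_const 2).mul_const ((hat ξ * hat ξ) i j)
    simpa using a.fun_add b
  simpa using (h2.fun_mul h3).const_add ((1 : Mat3) i j)

/-- A rotation `g` with `gᵀ e₃ = γ`, smooth in `γ` where `1 + σ γ₃ ≠ 0`. -/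
def frame (σ : ℝ) (γ : R3) : Mat3 :=
  !![1 - γ 0 ^ 2 * (1 + σ * γ 2)⁻¹, -(γ 0 * γ 1 * (1 + σ * γ 2)⁻¹), -(σ * γ 0);
    -(σ * γ 0 * γ 1 * (1 + σ * γ 2)⁻¹), σ * (1 - γ 1 ^ 2 * (1 + σ * γ 2)⁻¹), -γ 1;
    γ 0, γ 1, γ 2]

/-- The third row is `γ` and the first two complete it to an oriented orthonormal basis. No
continuous choice exists on the whole sphere, so `σ = ±1` gives two charts, each omitting one pole.
-/
theorem frame_mem {σ : ℝ} {γ : R3} (hσ : σ ^ 2 = 1) (hγ : γ ⬝ᵥ γ = 1) (h : 1 + σ * γ 2 ≠ 0) :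
    frame σ γ ∈ Matrix.specialOrthogonalGroup (Fin 3) ℝ := by
  rw [dot_three] at hγ
  have h2 : (1 + σ * γ 2)⁻¹ * (1 + σ * γ 2) = 1 := inv_mul_cancel₀ h
  have hq : γ 0 ^ 2 + γ 1 ^ 2 = (1 + σ * γ 2) * (1 - σ * γ 2) := by
    linear_combination hγ + γ 2 ^ 2 * hσ
  have hq' : (γ 0 ^ 2 + γ 1 ^ 2) * (1 + σ * γ 2)⁻¹ = 1 - σ * γ 2 := by
    rw [hq]; linear_combination (1 - σ * γ 2) * h2
  set k := (1 + σ * γ 2)⁻¹ with hk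
  rw [mem_SO3_iff]
  constructor
  · ext i j
    fin_cases i <;> fin_cases j <;>
      simp [frame, Matrix.mul_apply, Fin.sum_univ_three, ← hk]
    · linear_combination γ 0 ^ 2 * k * hq' - γ 0 ^ 2 * h2 + (γ 0 * γ 1 * k) ^ 2 * hσ
    · linear_combination γ 0 * γ 1 * k * hq' - γ 0 * γ 1 * h2
        - γ 0 * γ 1 * k * (1 - γ 1 ^ 2 * k) * hσ
    · linear_combination σ * γ 0 * hq' - γ 0 * γ 2 * hσ
    · linear_combination γ 0 * γ 1 * k * hq' - γ 0 * γ 1 * h2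
        - γ 0 * γ 1 * k * (1 - γ 1 ^ 2 * k) * hσ
    · linear_combination γ 1 ^ 2 * k * hq' - γ 1 ^ 2 * h2 + (1 - γ 1 ^ 2 * k) ^ 2 * hσ
    · linear_combination σ * γ 1 * hq' - γ 1 * γ 2 * hσ
    · linear_combination σ * γ 0 * hq' - γ 0 * γ 2 * hσ
    · linear_combination σ * γ 1 * hq' - γ 1 * γ 2 * hσ
    · linear_combination γ 0 ^ 2 * hσ + hγ
  · rw [Matrix.det_fin_three]
    simp [frame, ← hk]
    linear_combination (γ 0 ^ 2 + γ 2 ^ 2) * hσ - σ * γ 2 * hq' + hγ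

theorem frame_transpose_mulVec (σ : ℝ) (γ : R3) : (frame σ γ)ᵀ *ᵥ e3 = γ := by
  ext i; fin_cases i <;> simp [frame, e3, mulVec_three]

/-! ### Curves and tangent vectors -/

/-- The Lagrangian, the covectors, `γ` and `K` have degree at most two along ambient lines, so their
directional derivatives are read off as linear coefficients. -/
theorem hasDerivAt_of_quadratic {φ : ℝ → ℝ} {a b c : ℝ} (h : ∀ s, φ s = a + s * b + s ^ 2 * c) :
    HasDerivAt φ b 0 := by
  have h1 := ((hasDerivAt_id (0 : ℝ)).mul_const b).const_add a
  have h2 := ((hasDerivAt_id (0 : ℝ)).fun_pow 2).mul_const c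
  have h3 := h1.fun_add h2
  rw [show φ = fun s => a + s * b + s ^ 2 * c from funext h]
  simpa using h3

theorem hasDerivAt_fst {E F : Type*} [NormedAddCommGroup E] [NormedSpace ℝ E]
    [NormedAddCommGroup F] [NormedSpace ℝ F] {f : ℝ → E × F} {v : E × F} {t : ℝ}
    (h : HasDerivAt f v t) : HasDerivAt (fun s => (f s).1) v.1 t :=
  (ContinuousLinearMap.fst ℝ E F).hasFDerivAt.comp_hasDerivAt t h

theorem hasDerivAt_snd {E F : Type*} [NormedAddCommGroup E] [NormedSpace ℝ E]
    [NormedAddCommGroup F] [NormedSpace ℝ F] {f : ℝ → E × F} {v : E × F} {t : ℝ}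
    (h : HasDerivAt f v t) : HasDerivAt (fun s => (f s).2) v.2 t :=
  (ContinuousLinearMap.snd ℝ E F).hasFDerivAt.comp_hasDerivAt t h

theorem hasDerivAt_mulVec {G : ℝ → Mat3} {W : Mat3} {v : ℝ → R3} {w : R3}
    (hG : ∀ i j, HasDerivAt (fun t => G t i j) (W i j) 0)
    (hv : ∀ i, HasDerivAt (fun t => v t i) (w i) 0) (i : Fin 3) :
    HasDerivAt (fun t => (G t *ᵥ v t) i) ((W *ᵥ v 0 + G 0 *ᵥ w) i) 0 := by
  have h := HasDerivAt.fun_sum (u := Finset.univ) fun k _ => (hG i k).fun_mul (hv k)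
  rw [Finset.sum_add_distrib] at h
  exact h

theorem contDiff_mulVec {E : Type*} [NormedAddCommGroup E] [NormedSpace ℝ E] {n : WithTop ℕ∞}
    {G : E → Mat3} {v : E → R3} (hG : ∀ i j, ContDiff ℝ n (fun t => G t i j))
    (hv : ∀ i, ContDiff ℝ n (fun t => v t i)) (i : Fin 3) :
    ContDiff ℝ n (fun t => (G t *ᵥ v t) i) :=
  ContDiff.sum (s := Finset.univ) fun k _ => (hG i k).mul (hv k)

section Submanifold

variable {V : Type*} [NormedAddCommGroup V] [NormedSpace ℝ V] {S : Set V}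

theorem IsCurveThrough.hasDerivAt {c : ℝ → S} {x v : V} (h : IsCurveThrough c x v) :
    HasDerivAt (fun t => (c t : V)) v 0 := by
  have := (h.1.differentiable (by simp) 0).hasDerivAt
  rwa [h.2.2] at this

theorem IsCurveThrough.of_hasDerivAt {c : ℝ → S} {x v : V}
    (h : ContDiff ℝ ∞ (fun t => (c t : V))) (h0 : (c 0 : V) = x)
    (hd : HasDerivAt (fun t => (c t : V)) v 0) : IsCurveThrough c x v := ⟨h, h0, hd.deriv⟩

theorem LocallyExtends.differentiableAt {F : V → ℝ} {f : S → ℝ} {x : V}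
    (h : LocallyExtends F f x) : DifferentiableAt ℝ F x := by
  obtain ⟨U, hU, hx, hF, -⟩ := h
  exact (hF.contDiffAt (hU.mem_nhds hx)).differentiableAt (by simp)

/-- The derivative of a function along a curve, computed from a local extension. -/
theorem LocallyExtends.deriv_comp {F : V → ℝ} {f : S → ℝ} {x v : V} (h : LocallyExtends F f x)
    {c : ℝ → S} (hc : IsCurveThrough c x v) : deriv (fun t => f (c t)) 0 = fderiv ℝ F x v := by
  have hF := h.differentiableAt
  obtain ⟨U, hU, hx, -, hf⟩ := h
  have hd := hc.hasDerivAt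
  have h0 := hc.2.1
  have he : (fun t => f (c t)) =ᶠ[nhds 0] fun t => F (c t) := by
    have : ∀ᶠ t in nhds (0 : ℝ), (c t : V) ∈ U :=
      hd.continuousAt.eventually (by simp only [h0]; exact hU.mem_nhds hx)
    filter_upwards [this] with t ht using (hf _ ht).symm
  rw [he.deriv_eq]
  have hF' : HasFDerivAt F (fderiv ℝ F x) (c 0 : V) := by rw [h0]; exact hF.hasFDerivAt
  exact (hF'.comp_hasDerivAt (0 : ℝ) hd).deriv

end Submanifold

/-- A curve of rotations has skew-symmetric body velocity. -/
theorem skew_of_hasDerivAt {G : ℝ → Mat3} {W : Mat3}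
    (hG : ∀ t, G t ∈ Matrix.specialOrthogonalGroup (Fin 3) ℝ)
    (hd : ∀ i j, HasDerivAt (fun t => G t i j) (W i j) 0) :
    ((G 0)ᵀ * W)ᵀ = -((G 0)ᵀ * W) := by
  ext i j
  have h1 : HasDerivAt (fun t => ((G t)ᵀ * G t) i j)
      (∑ k, (W k i * G 0 k j + G 0 k i * W k j)) 0 := by
    simp only [Matrix.mul_apply, Matrix.transpose_apply]
    exact HasDerivAt.fun_sum fun k _ => (hd k i).fun_mul (hd k j)
  have h2 : (fun t => ((G t)ᵀ * G t) i j) = fun _ => (1 : Mat3) i j := by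
    funext t; rw [transpose_mul_self_of_mem (hG t)]
  rw [h2] at h1
  have h3 := h1.unique (hasDerivAt_const 0 _)
  simp only [Matrix.transpose_apply, Matrix.neg_apply, Matrix.mul_apply, Fin.sum_univ_three] at h3 ⊢
  linarith

theorem exists_eq_mul_hat {g W : Mat3} (hg : g ∈ Matrix.specialOrthogonalGroup (Fin 3) ℝ)
    (h : (gᵀ * W)ᵀ = -(gᵀ * W)) : ∃ ξ, W = g * hat ξ := by
  refine ⟨vee (gᵀ * W), ?_⟩
  rw [hat_vee h, ← mul_assoc, mul_transpose_self_of_mem hg, one_mul]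

theorem bodyAngVel_mul_hat {g : Mat3} (hg : g ∈ Matrix.specialOrthogonalGroup (Fin 3) ℝ)
    (ξ : R3) : bodyAngVel g (g * hat ξ) = ξ := by
  change vee (gᵀ * (g * hat ξ)) = ξ
  rw [← mul_assoc, transpose_mul_self_of_mem hg, one_mul, vee_hat]

theorem spaceAngVel_mul_hat {g : Mat3} (hg : g ∈ Matrix.specialOrthogonalGroup (Fin 3) ℝ)
    (ξ : R3) : spaceAngVel g (g * hat ξ) = g *ᵥ ξ := conj_hat hg ξ

theorem contDiff_mul_cayley (g : Mat3) (ξ : R3) (i j : Fin 3) :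
    ContDiff ℝ ∞ (fun t => (g * cayley ξ t) i j) := by
  simp only [Matrix.mul_apply]
  exact ContDiff.sum fun k _ => contDiff_const.mul (contDiff_cayley ξ k j)

theorem hasDerivAt_mul_cayley (g : Mat3) (ξ : R3) (i j : Fin 3) :
    HasDerivAt (fun t => (g * cayley ξ t) i j) ((g * hat ξ) i j) 0 := by
  simp only [Matrix.mul_apply]
  exact HasDerivAt.fun_sum fun k _ => (hasDerivAt_cayley ξ k j).const_mul (g i k)

/-- Differentiating `gᵀg = 1` gives one direction; a Cayley curve in `g` paired with a straight line
in `x` realizes every such vector. -/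
theorem mem_tangentVectors_Q {q : Conf} (hq : q ∈ Q) (w : Conf) :
    w ∈ tangentVectors Q q ↔ ∃ ξ, Matrix.of w.1 = Matrix.of q.1 * hat ξ := by
  constructor
  · rintro ⟨c, hc⟩
    have hd := hc.hasDerivAt
    have h1 : HasDerivAt (fun t => (c t : Conf).1) w.1 0 :=
      hasDerivAt_fst hd
    have h2 : ∀ i j, HasDerivAt (fun t => (c t : Conf).1 i j) (w.1 i j) 0 := fun i j =>
      hasDerivAt_pi.1 (hasDerivAt_pi.1 h1 i) j
    have h3 := skew_of_hasDerivAt (G := fun t => Matrix.of (c t : Conf).1) (W := Matrix.of w.1)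
      (fun t => (c t).2) h2
    simp only [hc.2.1] at h3
    exact exists_eq_mul_hat hq h3
  · rintro ⟨ξ, hξ⟩
    have hm : ∀ t, Matrix.of q.1 * cayley ξ t ∈ Matrix.specialOrthogonalGroup (Fin 3) ℝ :=
      fun t => mul_mem hq (cayley_mem ξ t)
    refine ⟨fun t => ⟨(Matrix.of.symm (Matrix.of q.1 * cayley ξ t), q.2 + t • w.2), hm t⟩,
      IsCurveThrough.of_hasDerivAt ?_ ?_ ?_⟩
    · refine ContDiff.prodMk ?_ (by fun_prop)
      exact contDiff_pi.2 fun i => contDiff_pi.2 fun j => contDiff_mul_cayley _ ξ i j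
    · simp [cayley_zero]
    · refine HasDerivAt.prodMk (f₁' := w.1) (f₂' := w.2) ?_ ?_
      · refine hasDerivAt_pi.2 fun i => hasDerivAt_pi.2 fun j => ?_
        have := hasDerivAt_mul_cayley (Matrix.of q.1) ξ i j
        rw [← hξ] at this
        exact this
      · simpa using ((hasDerivAt_id (0 : ℝ)).smul_const w.2).const_add q.2

/-! ### The constraint space and the distribution `𝓒` -/

namespace Body

variable (B : Body)

/-- The body angular velocity `𝕀⁻¹ M`. -/
def omega (M : R3) : R3 := fun i => M i / B.inertia i

theorem lagrangian_hasDerivAt (q w u : Conf) :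
    HasDerivAt (fun s : ℝ => B.lagrangian q (w + s • u))
      ((fun i => B.inertia i * bodyAngVel (Matrix.of q.1) (Matrix.of w.1) i) ⬝ᵥ
          bodyAngVel (Matrix.of q.1) (Matrix.of u.1)
        + (B.mass • w.2) ⬝ᵥ u.2) 0 := by
  refine hasDerivAt_of_quadratic (a := B.lagrangian q w) (c := B.lagrangian q u) fun s => ?_
  have e : bodyAngVel (Matrix.of q.1) (Matrix.of (w + s • u).1) =
      bodyAngVel (Matrix.of q.1) (Matrix.of w.1)
        + s • bodyAngVel (Matrix.of q.1) (Matrix.of u.1) := by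
    rw [← map_smul, ← map_add]; rfl
  simp only [lagrangian, e, inertiaTensor, Matrix.mulVec_diagonal, dot_three, Pi.add_apply,
    Pi.smul_apply, smul_eq_mul, Prod.snd_add, Prod.smul_snd]
  ring

variable {B}

/-- Tested on all tangent vectors, the Legendre condition says `M = 𝕀Ω` and `p = m ẋ`. Eliminating
`ẋ` by the constraint leaves a graph over `(g, x, M)`. -/
theorem mem_constraintSpace_iff (hI : ∀ i, 0 < B.inertia i) (z : Phase) :
    z ∈ B.constraintSpace ↔ Matrix.of z.1 ∈ Matrix.specialOrthogonalGroup (Fin 3) ℝ ∧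
      z.2.2.2 = (B.mass * B.r) • (B.A *ᵥ (Matrix.of z.1 *ᵥ B.omega z.2.2.1)) := by
  constructor
  · rintro ⟨hz, w, ⟨hw, hwc⟩, hL⟩
    refine ⟨hz, ?_⟩
    obtain ⟨ξ, hξ⟩ := (mem_tangentVectors_Q hz w).1 hw
    have hξ' : Matrix.of w.1 = Matrix.of z.1 * hat ξ := hξ
    have key : ∀ (η v : R3), z.2.2.1 ⬝ᵥ η + z.2.2.2 ⬝ᵥ v =
        (fun i => B.inertia i * ξ i) ⬝ᵥ η + (B.mass • w.2) ⬝ᵥ v := by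
      intro η v
      have h1 := hL (Matrix.of.symm (Matrix.of z.1 * hat η), v)
        ((mem_tangentVectors_Q hz _).2 ⟨η, rfl⟩)
      rw [(B.lagrangian_hasDerivAt _ _ _).deriv] at h1
      change z.2.2.1 ⬝ᵥ bodyAngVel (Matrix.of z.1) (Matrix.of z.1 * hat η) + z.2.2.2 ⬝ᵥ v =
        (fun i => B.inertia i * bodyAngVel (Matrix.of z.1) (Matrix.of w.1) i) ⬝ᵥ
          bodyAngVel (Matrix.of z.1) (Matrix.of z.1 * hat η) + (B.mass • w.2) ⬝ᵥ v at h1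
      rwa [hξ', bodyAngVel_mul_hat hz, bodyAngVel_mul_hat hz] at h1
    have hM : B.omega z.2.2.1 = ξ := by
      funext i
      have := key (Pi.single i 1) 0
      simp at this
      rw [omega, this, mul_div_cancel_left₀ _ (hI i).ne']
    have hp : z.2.2.2 = B.mass • w.2 := by
      funext i
      have := key 0 (Pi.single i 1)
      simpa using this
    rw [hp, hwc, hM]
    change B.mass • B.r • B.A *ᵥ spaceAngVel (Matrix.of z.1) (Matrix.of w.1) = _
    rw [hξ', spaceAngVel_mul_hat hz, smul_smul]
  · rintro ⟨hz, hp⟩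
    refine ⟨hz, (Matrix.of.symm (Matrix.of z.1 * hat (B.omega z.2.2.1)),
      B.r • B.A *ᵥ (Matrix.of z.1 *ᵥ B.omega z.2.2.1)),
      ⟨(mem_tangentVectors_Q hz _).2 ⟨_, rfl⟩, ?_⟩, ?_⟩
    · change _ = B.r • B.A *ᵥ spaceAngVel (Matrix.of z.1) (Matrix.of z.1 * hat _)
      rw [spaceAngVel_mul_hat hz]
    · intro u hu
      obtain ⟨η, hη⟩ := (mem_tangentVectors_Q hz u).1 hu
      have hη' : Matrix.of u.1 = Matrix.of z.1 * hat η := hη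
      rw [(B.lagrangian_hasDerivAt _ _ _).deriv]
      change z.2.2.1 ⬝ᵥ bodyAngVel (Matrix.of z.1) (Matrix.of u.1) + z.2.2.2 ⬝ᵥ u.2 =
        (fun i => B.inertia i * bodyAngVel (Matrix.of z.1)
          (Matrix.of z.1 * hat (B.omega z.2.2.1)) i) ⬝ᵥ
          bodyAngVel (Matrix.of z.1) (Matrix.of u.1) +
          (B.mass • B.r • B.A *ᵥ (Matrix.of z.1 *ᵥ B.omega z.2.2.1)) ⬝ᵥ u.2
      rw [bodyAngVel_mul_hat hz, hp, smul_smul]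
      congr 2
      funext i
      rw [omega, mul_div_cancel₀ _ (hI i).ne']

variable (B) in
/-- The vectors of `𝓒`, in terms of the body angular velocity `ξ` and the velocity `ζ` of `M`. -/
def distVec (z : Phase) (ξ ζ : R3) : Phase :=
  (Matrix.of.symm (Matrix.of z.1 * hat ξ), B.r • (B.A *ᵥ (Matrix.of z.1 *ᵥ ξ)), ζ,
    (B.mass * B.r) • (B.A *ᵥ (Matrix.of z.1 *ᵥ (ξ ⨯₃ B.omega z.2.2.1 + B.omega ζ))))

/-- The product rule for the graph equation of `𝓜`, with `ġ = g hat ξ` and `hat ξ Ω = ξ × Ω`. -/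
theorem hasDerivAt_momentum {G : ℝ → Mat3} {W : Mat3} {M : ℝ → R3} {ζ ξ : R3}
    (hG : ∀ i j, HasDerivAt (fun t => G t i j) (W i j) 0)
    (hM : ∀ i, HasDerivAt (fun t => M t i) (ζ i) 0) (hW : W = G 0 * hat ξ) :
    HasDerivAt (fun t => (B.mass * B.r) • (B.A *ᵥ (G t *ᵥ B.omega (M t))))
      ((B.mass * B.r) • (B.A *ᵥ (G 0 *ᵥ (ξ ⨯₃ B.omega (M 0) + B.omega ζ)))) 0 := by
  rw [Matrix.mulVec_add, ← hat_mulVec, Matrix.mulVec_mulVec _ (G 0) (hat ξ), ← hW]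
  refine hasDerivAt_pi.2 fun i => ?_
  refine HasDerivAt.const_mul (B.mass * B.r) ?_
  have h := hasDerivAt_mulVec (G := fun _ => B.A) (W := 0) (fun j k => hasDerivAt_const 0 (B.A j k))
    (hasDerivAt_mulVec hG (v := fun t => B.omega (M t)) (w := B.omega ζ)
      fun k => (hM k).div_const _) i
  rwa [Matrix.zero_mulVec, zero_add] at h

theorem mem_distributionC_iff (hI : ∀ i, 0 < B.inertia i) {z : Phase} (hz : z ∈ B.constraintSpace)
    (Z : Phase) : Z ∈ B.distributionC z ↔ ∃ ξ ζ, Z = B.distVec z ξ ζ := by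
  obtain ⟨hg, hp⟩ := (mem_constraintSpace_iff hI z).1 hz
  constructor
  · rintro ⟨⟨c, hc⟩, hw, hwc⟩
    obtain ⟨ξ, hξ⟩ := (mem_tangentVectors_Q hg _).1 hw
    have hξ' : Matrix.of Z.1 = Matrix.of z.1 * hat ξ := hξ
    refine ⟨ξ, Z.2.2.1, ?_⟩
    have hd := hc.hasDerivAt
    have h1 : HasDerivAt (fun t => (c t : Phase).1) Z.1 0 :=
      hasDerivAt_fst hd
    have h2 : HasDerivAt (fun t => (c t : Phase).2) Z.2 0 :=
      hasDerivAt_snd hd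
    have h3 : HasDerivAt (fun t => (c t : Phase).2.2) Z.2.2 0 :=
      hasDerivAt_snd h2
    have hM : HasDerivAt (fun t => (c t : Phase).2.2.1) Z.2.2.1 0 :=
      hasDerivAt_fst h3
    have hP : HasDerivAt (fun t => (c t : Phase).2.2.2) Z.2.2.2 0 :=
      hasDerivAt_snd h3
    have hP' := hasDerivAt_momentum (B := B) (G := fun t => Matrix.of (c t : Phase).1)
      (W := Matrix.of Z.1) (M := fun t => (c t : Phase).2.2.1) (ζ := Z.2.2.1) (ξ := ξ)
      (fun i j => hasDerivAt_pi.1 (hasDerivAt_pi.1 h1 i) j) (hasDerivAt_pi.1 hM)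
      (by simp only [hc.2.1]; exact hξ')
    have e : (fun t => (c t : Phase).2.2.2) = fun t => (B.mass * B.r) •
        (B.A *ᵥ (Matrix.of (c t : Phase).1 *ᵥ B.omega (c t : Phase).2.2.1)) :=
      funext fun t => ((mem_constraintSpace_iff hI _).1 (c t).2).2
    rw [← e] at hP'
    have hp' := hP.unique hP'
    simp only [hc.2.1] at hp'
    refine Prod.ext hξ' (Prod.ext ?_ (Prod.ext rfl hp'))
    change Z.2.1 = B.r • B.A *ᵥ spaceAngVel (Matrix.of z.1) (Matrix.of Z.1) at hwc
    rw [hwc, hξ', spaceAngVel_mul_hat hg]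
    rfl
  · rintro ⟨ξ, ζ, rfl⟩
    refine ⟨?_, (mem_tangentVectors_Q hg _).2 ⟨ξ, rfl⟩, ?_⟩
    · have hm : ∀ t, Matrix.of z.1 * cayley ξ t ∈ Matrix.specialOrthogonalGroup (Fin 3) ℝ :=
        fun t => mul_mem hg (cayley_mem ξ t)
      have hc0 : Matrix.of z.1 * cayley ξ 0 = Matrix.of z.1 := by rw [cayley_zero, mul_one]
      -- The components `g`, `x`, `M` may be moved freely; `p` is then dictated by the graph
      -- equation, which keeps the curve in `𝓜`.
      let c : ℝ → Phase := fun t => (Matrix.of.symm (Matrix.of z.1 * cayley ξ t),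
        z.2.1 + t • (B.r • (B.A *ᵥ (Matrix.of z.1 *ᵥ ξ))), z.2.2.1 + t • ζ,
        (B.mass * B.r) • (B.A *ᵥ ((Matrix.of z.1 * cayley ξ t) *ᵥ B.omega (z.2.2.1 + t • ζ))))
      have hcM : ∀ t, c t ∈ B.constraintSpace := fun t =>
        (mem_constraintSpace_iff hI _).2 ⟨hm t, rfl⟩
      refine ⟨fun t => ⟨c t, hcM t⟩, IsCurveThrough.of_hasDerivAt ?_ ?_ ?_⟩
      · refine ContDiff.prodMk ?_ (ContDiff.prodMk (by fun_prop) (ContDiff.prodMk (by fun_prop) ?_))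
        · exact contDiff_pi.2 fun i => contDiff_pi.2 fun j => contDiff_mul_cayley _ ξ i j
        · refine contDiff_pi.2 fun i => ?_
          refine contDiff_const.mul (contDiff_mulVec (G := fun _ => B.A)
            (fun _ _ => contDiff_const)
            (contDiff_mulVec (contDiff_mul_cayley _ ξ) fun k => ?_) i)
          simp only [omega, Pi.add_apply, Pi.smul_apply]
          fun_prop
      · refine Prod.ext ?_ (Prod.ext ?_ (Prod.ext ?_ ?_))
        · exact hc0
        · simp [c]
        · simp [c]
        · simp only [c, hc0, zero_smul, add_zero]; exact hp.symm
      · have hM : HasDerivAt (fun t : ℝ => z.2.2.1 + t • ζ) ζ 0 := by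
          simpa using ((hasDerivAt_id (0 : ℝ)).smul_const ζ).const_add z.2.2.1
        refine HasDerivAt.prodMk ?_ (HasDerivAt.prodMk ?_ (HasDerivAt.prodMk hM ?_))
        · exact hasDerivAt_pi.2 fun i => hasDerivAt_pi.2 fun j => hasDerivAt_mul_cayley _ ξ i j
        · simpa using ((hasDerivAt_id (0 : ℝ)).smul_const
            (B.r • (B.A *ᵥ (Matrix.of z.1 *ᵥ ξ)))).const_add z.2.1
        · have := hasDerivAt_momentum (B := B) (G := fun t => Matrix.of z.1 * cayley ξ t)
            (W := Matrix.of z.1 * hat ξ) (M := fun t : ℝ => z.2.2.1 + t • ζ) (ζ := ζ) (ξ := ξ)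
            (hasDerivAt_mul_cayley _ ξ) (hasDerivAt_pi.1 hM) (by simp only [hc0])
          simpa only [hc0, zero_smul, add_zero] using this
    · change _ = B.r • B.A *ᵥ spaceAngVel (Matrix.of z.1) (Matrix.of z.1 * hat ξ)
      rw [spaceAngVel_mul_hat hg]
      rfl

end Body

/-! ### Cross products and derivatives of covectors -/

theorem cross_zero (u v : R3) : (u ⨯₃ v) 0 = u 1 * v 2 - u 2 * v 1 := by
  rw [cross_apply]; rfl

theorem cross_one (u v : R3) : (u ⨯₃ v) 1 = u 2 * v 0 - u 0 * v 2 := by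
  rw [cross_apply]; rfl

theorem cross_two (u v : R3) : (u ⨯₃ v) 2 = u 0 * v 1 - u 1 * v 0 := by
  rw [cross_apply]; rfl

theorem ext_three {u v : R3} (h0 : u 0 = v 0) (h1 : u 1 = v 1) (h2 : u 2 = v 2) : u = v := by
  ext i; fin_cases i <;> assumption

/-- The skew part of `hat u * hat v` is half the commutator. The two halves coming from the two
terms of `canonicalForm_eq` add up to the Maurer-Cartan term `M · (ξ × ξ')`. -/
theorem vee_hat_mul_hat (u v : R3) : vee (hat u * hat v) = (1 / 2 : ℝ) • (u ⨯₃ v) := by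
  rw [cross_apply]
  ext i
  fin_cases i <;> simp [vee, hat] <;> ring

theorem linearMap_apply_eq (ℓ : R3 × R3 →ₗ[ℝ] ℝ) (x : R3 × R3) :
    ℓ x = (fun i => ℓ (Pi.single i 1, 0)) ⬝ᵥ x.1 + (fun i => ℓ (0, Pi.single i 1)) ⬝ᵥ x.2 := by
  have h1 : ∀ v : R3, v = ∑ i, v i • Pi.single (M := fun _ => ℝ) i (1 : ℝ) := fun v =>
    pi_eq_sum_univ' v
  have h2 : x = LinearMap.inl ℝ R3 R3 x.1 + LinearMap.inr ℝ R3 R3 x.2 := by simp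
  conv_lhs => rw [h2, map_add, h1 x.1, h1 x.2]
  simp only [map_sum, map_smul, smul_eq_mul, dotProduct, LinearMap.inl_apply, LinearMap.inr_apply,
    mul_comm]

theorem fderiv_covector (z Y : Phase) (w : Conf) :
    fderiv ℝ (fun z' => covector z' w) z Y =
      Y.2.2.1 ⬝ᵥ bodyAngVel (Matrix.of z.1) (Matrix.of w.1)
        + z.2.2.1 ⬝ᵥ bodyAngVel (Matrix.of Y.1) (Matrix.of w.1) + Y.2.2.2 ⬝ᵥ w.2 := by
  have h1 := ((contDiff_covector w).differentiable (by simp) z).hasFDerivAt.hasLineDerivAt Y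
  refine HasDerivAt.unique h1 (hasDerivAt_of_quadratic (a := covector z w)
    (c := Y.2.2.1 ⬝ᵥ bodyAngVel (Matrix.of Y.1) (Matrix.of w.1)) fun s => ?_)
  have e : bodyAngVel (Matrix.of (z + s • Y).1) (Matrix.of w.1) =
      bodyAngVel (Matrix.of z.1) (Matrix.of w.1)
        + s • bodyAngVel (Matrix.of Y.1) (Matrix.of w.1) := by
    have e' : Matrix.of (z + s • Y).1 = Matrix.of z.1 + s • Matrix.of Y.1 := rfl
    rw [e']
    change vee ((Matrix.of z.1 + s • Matrix.of Y.1)ᵀ * Matrix.of w.1) =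
      vee ((Matrix.of z.1)ᵀ * Matrix.of w.1) + s • vee ((Matrix.of Y.1)ᵀ * Matrix.of w.1)
    rw [Matrix.transpose_add, Matrix.transpose_smul, Matrix.add_mul, Matrix.smul_mul, map_add,
      map_smul]
  change (z.2.2.1 + s • Y.2.2.1) ⬝ᵥ bodyAngVel (Matrix.of (z + s • Y).1) (Matrix.of w.1)
    + (z.2.2.2 + s • Y.2.2.2) ⬝ᵥ w.2 = z.2.2.1 ⬝ᵥ bodyAngVel (Matrix.of z.1) (Matrix.of w.1)
      + z.2.2.2 ⬝ᵥ w.2 + _ + _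
  rw [e]
  simp only [dot_three, Pi.add_apply, Pi.smul_apply, smul_eq_mul]
  ring

/-! ### The matrix `AᵀA` and the inversion of `Ω ↦ K` -/

namespace Body

/-- `Aᵀ A = a E + b e₃ e₃ᵀ`, with coefficients such that this matrix is a projection. -/
structure IsCoupled (B : Body) (a b : ℝ) : Prop where
  gram : B.Aᵀ * B.A = a • (1 : Mat3) + b • Matrix.vecMulVec e3 e3
  nonneg : 0 ≤ a
  cases : 0 ≤ b ∨ a = 1 ∧ b = -1

variable (B : Body)

/-- The entries of the diagonal matrix `𝕀 + a m r² E`. -/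
def shiftedInertia (a : ℝ) : R3 := fun i => B.inertia i + B.mass * B.r ^ 2 * a

/-- The kinetic momentum as a function of the angular velocity. -/
def momentumOf (a b : ℝ) (γ Ω : R3) : R3 :=
  B.shiftedInertia a * Ω + (B.mass * B.r ^ 2 * b * (γ ⬝ᵥ Ω)) • γ

/-- The angular velocity as a function of the kinetic momentum (Sherman-Morrison formula). -/
def velocityOf (a b : ℝ) (γ K : R3) : R3 :=
  K / B.shiftedInertia a - (B.mass * B.r ^ 2 * b * ((K ⬝ᵥ (γ / B.shiftedInertia a)) /
    (γ ⬝ᵥ γ + B.mass * B.r ^ 2 * b * (γ ⬝ᵥ (γ / B.shiftedInertia a))))) •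
      (γ / B.shiftedInertia a)

/-- The vector `K + m r² a Ω + m r² b (Ω · γ) γ`. -/
def gyroVector (a b : ℝ) (γ K : R3) : R3 :=
  K + (B.mass * B.r ^ 2 * a) • B.velocityOf a b γ K
    + (B.mass * B.r ^ 2 * b * (B.velocityOf a b γ K ⬝ᵥ γ)) • γ

variable {B} {a b : ℝ}

theorem shiftedInertia_pos (hI : ∀ i, 0 < B.inertia i) (hm : 0 < B.mass) (ha : 0 ≤ a)
    (i : Fin 3) : 0 < B.shiftedInertia a i :=
  add_pos_of_pos_of_nonneg (hI i) (by positivity)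

/-- For `b ≥ 0` nothing negative is added to `‖γ‖² = 1`. For `(a, b) = (1, -1)` the subtracted terms
are absorbed: `1 - m r²/(Iᵢ + m r²) = Iᵢ/(Iᵢ + m r²)`. -/
theorem IsCoupled.den_pos (h : B.IsCoupled a b) (hI : ∀ i, 0 < B.inertia i) (hm : 0 < B.mass)
    {γ : R3} (hγ : γ ⬝ᵥ γ = 1) :
    0 < γ ⬝ᵥ γ + B.mass * B.r ^ 2 * b * (γ ⬝ᵥ (γ / B.shiftedInertia a)) := by
  have hd := shiftedInertia_pos hI hm h.nonneg
  have hs : ∀ i, γ i * (γ i / B.shiftedInertia a i) = γ i ^ 2 / B.shiftedInertia a i := fun i => by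
    ring
  rcases h.cases with hb | ⟨rfl, rfl⟩
  · rw [hγ]
    have : 0 ≤ γ ⬝ᵥ (γ / B.shiftedInertia a) :=
      Finset.sum_nonneg fun i _ => by
        rw [Pi.div_apply, hs]; exact div_nonneg (sq_nonneg _) (hd i).le
    positivity
  · have e : γ ⬝ᵥ γ + B.mass * B.r ^ 2 * -1 * (γ ⬝ᵥ (γ / B.shiftedInertia 1)) =
        ∑ i, γ i * γ i * (B.inertia i / B.shiftedInertia 1 i) := by
      rw [dotProduct, dotProduct, Finset.mul_sum, ← Finset.sum_add_distrib]
      refine Finset.sum_congr rfl fun i _ => ?_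
      have := (hd i).ne'
      rw [Pi.div_apply]
      field_simp
      rw [shiftedInertia]
      ring
    rw [e]
    have hne : ∃ i, γ i ≠ 0 := by
      by_contra! h0
      simp [dot_three, h0] at hγ
    obtain ⟨i, hi⟩ := hne
    refine Finset.sum_pos' (fun j _ => ?_) ⟨i, Finset.mem_univ i, ?_⟩
    · exact mul_nonneg (mul_self_nonneg _) (div_nonneg (hI j).le (hd j).le)
    · exact mul_pos (mul_self_pos.2 hi) (div_pos (hI i) (hd i))

/-- Sherman-Morrison for `D + m r² b γγᵀ`, with `D` the shifted inertia. Its denominator begins with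
`1`, not `γ ⬝ᵥ γ`, so the level set is needed. Pairing with `γ` first reduces the matter to the
scalar `γ · Ω`. -/
theorem IsCoupled.momentumOf_velocityOf (h : B.IsCoupled a b) (hI : ∀ i, 0 < B.inertia i)
    (hm : 0 < B.mass) {γ : R3} (hγ : γ ⬝ᵥ γ = 1) (K : R3) :
    B.momentumOf a b γ (B.velocityOf a b γ K) = K := by
  have hd := fun i => (shiftedInertia_pos hI hm h.nonneg i).ne'
  have hden := (h.den_pos hI hm hγ).ne'
  have e : γ ⬝ᵥ B.velocityOf a b γ K = K ⬝ᵥ (γ / B.shiftedInertia a) /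
      (γ ⬝ᵥ γ + B.mass * B.r ^ 2 * b * (γ ⬝ᵥ (γ / B.shiftedInertia a))) := by
    have e1 : γ ⬝ᵥ (K / B.shiftedInertia a) = K ⬝ᵥ (γ / B.shiftedInertia a) := by
      simp only [dot_three, Pi.div_apply]; ring
    rw [velocityOf, dotProduct_sub, dotProduct_smul, smul_eq_mul, e1]
    rw [hγ] at hden ⊢
    field_simp
    ring
  rw [momentumOf, e, velocityOf]
  ext i
  have := hd i
  simp only [Pi.add_apply, Pi.mul_apply, Pi.sub_apply, Pi.div_apply, Pi.smul_apply, smul_eq_mul]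
  field_simp
  ring

theorem IsCoupled.velocityOf_momentumOf (h : B.IsCoupled a b) (hI : ∀ i, 0 < B.inertia i)
    (hm : 0 < B.mass) {γ : R3} (hγ : γ ⬝ᵥ γ = 1) (Ω : R3) :
    B.velocityOf a b γ (B.momentumOf a b γ Ω) = Ω := by
  have hd := fun i => (shiftedInertia_pos hI hm h.nonneg i).ne'
  have hden := (h.den_pos hI hm hγ).ne'
  have e : B.momentumOf a b γ Ω ⬝ᵥ (γ / B.shiftedInertia a) = (γ ⬝ᵥ Ω) *
      (γ ⬝ᵥ γ + B.mass * B.r ^ 2 * b * (γ ⬝ᵥ (γ / B.shiftedInertia a))) := by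
    have e1 : (B.shiftedInertia a * Ω) ⬝ᵥ (γ / B.shiftedInertia a) = γ ⬝ᵥ Ω := by
      refine Finset.sum_congr rfl fun i _ => ?_
      have := hd i
      simp only [Pi.mul_apply, Pi.div_apply]
      field_simp
    rw [momentumOf, add_dotProduct, smul_dotProduct, smul_eq_mul, e1, hγ]
    ring
  rw [velocityOf, e, mul_div_cancel_right₀ _ hden, momentumOf]
  ext i
  have := hd i
  simp only [Pi.add_apply, Pi.mul_apply, Pi.sub_apply, Pi.div_apply, Pi.smul_apply, smul_eq_mul]
  field_simp
  ring

/-! ### The differential of `(γ, K)` and the canonical form on `𝓒` -/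

variable (B) in
theorem contDiff_poisson_kinetic :
    ContDiff ℝ ∞ fun z => (poissonVector z, B.kineticMomentum z) := by
  refine ContDiff.prodMk (contDiff_pi.2 fun i => ?_) (contDiff_pi.2 fun i => ?_)
  · exact contDiff_mulVec (G := fun z : Phase => (Matrix.of z.1)ᵀ)
      (fun i j => by simp only [Matrix.transpose_apply, Matrix.of_apply]; fun_prop)
      (v := fun _ => e3) (fun _ => contDiff_const) i
  · refine ContDiff.add (by fun_prop) (contDiff_const.mul (contDiff_mulVec
      (G := fun z : Phase => (Matrix.of z.1)ᵀ)
      (fun i j => by simp only [Matrix.transpose_apply, Matrix.of_apply]; fun_prop)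
      (contDiff_mulVec (G := fun _ => B.Aᵀ) (fun _ _ => contDiff_const) (fun k => by fun_prop)) i))

variable (B) in
/-- The differential of the Poisson vector and the kinetic momentum. -/
theorem fderiv_poisson_kinetic (z Z : Phase) :
    fderiv ℝ (fun z' => (poissonVector z', B.kineticMomentum z')) z Z =
      ((Matrix.of Z.1)ᵀ *ᵥ e3, Z.2.2.1 + B.r • ((Matrix.of Z.1)ᵀ *ᵥ (B.Aᵀ *ᵥ z.2.2.2)
        + (Matrix.of z.1)ᵀ *ᵥ (B.Aᵀ *ᵥ Z.2.2.2))) := by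
  have h1 := ((contDiff_poisson_kinetic B).differentiable (by simp) z).hasFDerivAt.hasLineDerivAt Z
  refine HasDerivAt.unique h1 (HasDerivAt.prodMk (hasDerivAt_pi.2 fun i => ?_)
    (hasDerivAt_pi.2 fun i => ?_))
  · refine hasDerivAt_of_quadratic (a := poissonVector z i) (c := 0) fun s => ?_
    change ((Matrix.of z.1 + s • Matrix.of Z.1)ᵀ *ᵥ e3) i = ((Matrix.of z.1)ᵀ *ᵥ e3) i + _ + _
    simp only [Matrix.transpose_add, Matrix.transpose_smul, Matrix.add_mulVec, Matrix.smul_mulVec,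
      Pi.add_apply, Pi.smul_apply, smul_eq_mul]
    ring
  · refine hasDerivAt_of_quadratic (a := B.kineticMomentum z i)
      (c := B.r * ((Matrix.of Z.1)ᵀ *ᵥ (B.Aᵀ *ᵥ Z.2.2.2)) i) fun s => ?_
    change (z.2.2.1 + s • Z.2.2.1 + B.r • ((Matrix.of z.1 + s • Matrix.of Z.1)ᵀ *ᵥ
      (B.Aᵀ *ᵥ (z.2.2.2 + s • Z.2.2.2)))) i =
      (z.2.2.1 + B.r • ((Matrix.of z.1)ᵀ *ᵥ (B.Aᵀ *ᵥ z.2.2.2))) i + _ + _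
    simp only [Matrix.transpose_add, Matrix.transpose_smul, Matrix.add_mulVec, Matrix.smul_mulVec,
      Matrix.mulVec_add, Matrix.mulVec_smul, Pi.add_apply, Pi.smul_apply, smul_eq_mul]
    ring

theorem poissonVector_dot_self {z : Phase}
    (hg : Matrix.of z.1 ∈ Matrix.specialOrthogonalGroup (Fin 3) ℝ) :
    poissonVector z ⬝ᵥ poissonVector z = 1 := by
  rw [poissonVector, Matrix.dotProduct_mulVec, Matrix.vecMul_transpose, Matrix.mulVec_mulVec,
    mul_transpose_self_of_mem hg, Matrix.one_mulVec]
  simp [e3]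

/-- The matrix `gᵀ Aᵀ A g` is `a E + b γ γᵀ`. -/
theorem IsCoupled.gram_conj (h : B.IsCoupled a b) {z : Phase}
    (hg : Matrix.of z.1 ∈ Matrix.specialOrthogonalGroup (Fin 3) ℝ) (v : R3) :
    (Matrix.of z.1)ᵀ *ᵥ (B.Aᵀ *ᵥ (B.A *ᵥ (Matrix.of z.1 *ᵥ v))) =
      a • v + (b * (poissonVector z ⬝ᵥ v)) • poissonVector z := by
  have e : e3 ⬝ᵥ (Matrix.of z.1 *ᵥ v) = poissonVector z ⬝ᵥ v := by
    rw [poissonVector, Matrix.dotProduct_mulVec, Matrix.mulVec_transpose]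
  rw [Matrix.mulVec_mulVec _ B.Aᵀ, h.gram, Matrix.add_mulVec, Matrix.smul_mulVec,
    Matrix.smul_mulVec, Matrix.one_mulVec, Matrix.vecMulVec_mulVec, e, Matrix.mulVec_add,
    Matrix.mulVec_smul, Matrix.mulVec_mulVec, transpose_mul_self_of_mem hg, Matrix.one_mulVec]
  congr 1
  rw [poissonVector]
  ext i
  simp [Matrix.mulVec_smul]
  ring

theorem IsCoupled.dot_conj (h : B.IsCoupled a b) {z : Phase}
    (hg : Matrix.of z.1 ∈ Matrix.specialOrthogonalGroup (Fin 3) ℝ) (u v : R3) :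
    (B.A *ᵥ (Matrix.of z.1 *ᵥ u)) ⬝ᵥ (B.A *ᵥ (Matrix.of z.1 *ᵥ v)) =
      a * (u ⬝ᵥ v) + b * (poissonVector z ⬝ᵥ u) * (poissonVector z ⬝ᵥ v) := by
  have := congrArg (fun w => w ⬝ᵥ v) (h.gram_conj hg u)
  simp only [add_dotProduct, smul_dotProduct, smul_eq_mul] at this
  rw [← this, Matrix.mulVec_transpose, ← Matrix.dotProduct_mulVec, Matrix.mulVec_transpose,
    ← Matrix.dotProduct_mulVec]

theorem inertia_mul_omega (hI : ∀ i, 0 < B.inertia i) (M : R3) : B.inertia * B.omega M = M :=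
  funext fun i => mul_div_cancel₀ (M i) (hI i).ne'

theorem IsCoupled.kineticMomentum_eq (h : B.IsCoupled a b) (hI : ∀ i, 0 < B.inertia i) {z : Phase}
    (hz : z ∈ B.constraintSpace) :
    B.kineticMomentum z = B.momentumOf a b (poissonVector z) (B.omega z.2.2.1) := by
  obtain ⟨hg, hp⟩ := (mem_constraintSpace_iff hI z).1 hz
  rw [kineticMomentum, hp, Matrix.mulVec_smul, Matrix.mulVec_smul, h.gram_conj hg, momentumOf]
  ext i
  have := congrFun (inertia_mul_omega hI z.2.2.1) i
  simp only [Pi.mul_apply] at this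
  simp only [Pi.add_apply, Pi.smul_apply, Pi.mul_apply, smul_eq_mul, shiftedInertia]
  linear_combination -this

theorem IsCoupled.velocityOf_kineticMomentum (h : B.IsCoupled a b) (hI : ∀ i, 0 < B.inertia i)
    (hm : 0 < B.mass) {z : Phase} (hz : z ∈ B.constraintSpace) :
    B.velocityOf a b (poissonVector z) (B.kineticMomentum z) = B.omega z.2.2.1 := by
  rw [h.kineticMomentum_eq hI hz, h.velocityOf_momentumOf hI hm
    (poissonVector_dot_self ((mem_constraintSpace_iff hI z).1 hz).1)]

/-- The velocity of the kinetic momentum along `distVec`, for `Ω = 𝕀⁻¹ M` and `η = 𝕀⁻¹ ζ`. -/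
def momentumVel (B : Body) (a b : ℝ) (γ Ω ξ η : R3) : R3 :=
  B.momentumOf a b γ η
    + (B.mass * B.r ^ 2 * b) • ((γ ⬝ᵥ (ξ ⨯₃ Ω)) • γ - (γ ⬝ᵥ Ω) • (ξ ⨯₃ γ))

theorem transpose_mul_hat_mulVec (g : Mat3) (ξ v : R3) :
    (g * hat ξ)ᵀ *ᵥ v = (gᵀ *ᵥ v) ⨯₃ ξ := by
  rw [Matrix.transpose_mul, hat_transpose, ← Matrix.mulVec_mulVec, Matrix.neg_mulVec, hat_mulVec,
    cross_anticomm]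

/-- On `𝓜`, `K` depends on `g` only through `b (γ · Ω) γ`; differentiating this with `γ̇ = γ × ξ`
gives the extra terms of `momentumVel`. -/
theorem IsCoupled.fderiv_poisson_kinetic_distVec (h : B.IsCoupled a b)
    (hI : ∀ i, 0 < B.inertia i) {z : Phase} (hz : z ∈ B.constraintSpace) (ξ ζ : R3) :
    fderiv ℝ (fun z' => (poissonVector z', B.kineticMomentum z')) z (B.distVec z ξ ζ) =
      (poissonVector z ⨯₃ ξ,
        B.momentumVel a b (poissonVector z) (B.omega z.2.2.1) ξ (B.omega ζ)) := by
  obtain ⟨hg, hp⟩ := (mem_constraintSpace_iff hI z).1 hz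
  have hζ := inertia_mul_omega hI ζ
  rw [fderiv_poisson_kinetic, distVec]
  simp only [Equiv.apply_symm_apply, transpose_mul_hat_mulVec, hp, Matrix.mulVec_smul,
    h.gram_conj hg]
  refine Prod.ext rfl ?_
  simp only [momentumVel, momentumOf]
  generalize B.omega ζ = η at *
  generalize B.omega z.2.2.1 = Ω at *
  generalize poissonVector z = γ at *
  rw [← hζ]
  refine ext_three ?_ ?_ ?_ <;>
  · simp only [Pi.add_apply, Pi.sub_apply, Pi.mul_apply, Pi.smul_apply, smul_eq_mul, map_add,
      map_smul, LinearMap.add_apply, LinearMap.smul_apply, cross_zero, cross_one, cross_two,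
      dot_three, shiftedInertia]
    ring

/-- In terms of `θ = K · λ + p · ε`, the `K` part of the gyroscopic vector comes from `dλ`, and the
remainder `m r² (a Ω + b (Ω · γ) γ)` from `p · dε`, since `dε` does not vanish on `𝓒`. -/
theorem IsCoupled.canonicalForm_distVec (h : B.IsCoupled a b) (hI : ∀ i, 0 < B.inertia i)
    (hm : 0 < B.mass) {z : Phase} (hz : z ∈ B.constraintSpace) (ξ ζ ξ' ζ' : R3) :
    canonicalForm z (B.distVec z ξ ζ) (B.distVec z ξ' ζ') =
      B.momentumVel a b (poissonVector z) (B.omega z.2.2.1) ξ' (B.omega ζ') ⬝ᵥ ξ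
      - B.momentumVel a b (poissonVector z) (B.omega z.2.2.1) ξ (B.omega ζ) ⬝ᵥ ξ'
      + B.gyroVector a b (poissonVector z) (B.kineticMomentum z) ⬝ᵥ (ξ ⨯₃ ξ') := by
  obtain ⟨hg, hp⟩ := (mem_constraintSpace_iff hI z).1 hz
  have hb : ∀ u v, bodyAngVel (Matrix.of z.1 * hat u) (Matrix.of z.1 * hat v) =
      -((1 / 2 : ℝ) • (u ⨯₃ v)) := by
    intro u v
    change vee ((Matrix.of z.1 * hat u)ᵀ * (Matrix.of z.1 * hat v)) = _
    rw [Matrix.transpose_mul, mul_assoc, ← mul_assoc _ (Matrix.of z.1),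
      transpose_mul_self_of_mem hg, one_mul, hat_transpose, neg_mul, map_neg, vee_hat_mul_hat]
  have hζ := inertia_mul_omega hI ζ
  have hζ' := inertia_mul_omega hI ζ'
  have hM := inertia_mul_omega hI z.2.2.1
  rw [canonicalForm_eq, fderiv_covector, fderiv_covector, gyroVector,
    h.velocityOf_kineticMomentum hI hm hz, h.kineticMomentum_eq hI hz]
  simp only [distVec, proj, LinearMap.coe_mk, AddHom.coe_mk, Equiv.apply_symm_apply, hb,
    bodyAngVel_mul_hat hg, smul_dotProduct, dotProduct_smul, h.dot_conj hg, smul_eq_mul]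
  simp only [momentumVel, momentumOf]
  -- With momenta rewritten as `𝕀` times velocities, what remains is a polynomial identity in
  -- independent variables.
  generalize B.omega ζ = η at *
  generalize B.omega ζ' = η' at *
  generalize B.omega z.2.2.1 = Ω at *
  rw [← hM, ← hζ, ← hζ']
  generalize poissonVector z = γ at *
  simp only [dot_three, Pi.add_apply, Pi.sub_apply, Pi.mul_apply, Pi.smul_apply, Pi.neg_apply,
    smul_eq_mul, cross_zero, cross_one, cross_two, shiftedInertia]
  ring

/-! ### Linear coordinates `(ξ, κ)` on `𝓒` -/

variable (B) in
theorem omega_add (M N : R3) : B.omega (M + N) = B.omega M + B.omega N :=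
  funext fun _ => add_div _ _ _

variable (B) in
theorem omega_smul (t : ℝ) (M : R3) : B.omega (t • M) = t • B.omega M :=
  funext fun _ => mul_div_assoc _ _ _

variable (B) in
theorem velocityOf_add (a b : ℝ) (γ K L : R3) :
    B.velocityOf a b γ (K + L) = B.velocityOf a b γ K + B.velocityOf a b γ L := by
  ext i
  simp only [velocityOf, add_dotProduct, Pi.add_apply, Pi.sub_apply, Pi.div_apply, Pi.smul_apply,
    smul_eq_mul]
  ring

variable (B) in
theorem velocityOf_smul (a b t : ℝ) (γ K : R3) :
    B.velocityOf a b γ (t • K) = t • B.velocityOf a b γ K := by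
  ext i
  simp only [velocityOf, smul_dotProduct, Pi.sub_apply, Pi.div_apply, Pi.smul_apply,
    smul_eq_mul]
  ring

theorem hat_add (ξ η : R3) : hat (ξ + η) = hat ξ + hat η := by
  ext i j; fin_cases i <;> fin_cases j <;> simp [hat] <;> ring

theorem hat_smul (t : ℝ) (ξ : R3) : hat (t • ξ) = t • hat ξ := by
  ext i j; fin_cases i <;> fin_cases j <;> simp [hat]

theorem distVec_add (z : Phase) (ξ ζ ξ' ζ' : R3) :
    B.distVec z (ξ + ξ') (ζ + ζ') = B.distVec z ξ ζ + B.distVec z ξ' ζ' := by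
  refine Prod.ext ?_ (Prod.ext ?_ (Prod.ext rfl ?_))
  · change Matrix.of z.1 * hat (ξ + ξ') = Matrix.of z.1 * hat ξ + Matrix.of z.1 * hat ξ'
    rw [hat_add, mul_add]
  · simp only [distVec, Matrix.mulVec_add, smul_add, Prod.snd_add, Prod.fst_add]
  · simp only [distVec, map_add, LinearMap.add_apply, omega_add, Matrix.mulVec_add, smul_add,
      Prod.snd_add]
    abel

theorem distVec_smul (z : Phase) (t : ℝ) (ξ ζ : R3) :
    B.distVec z (t • ξ) (t • ζ) = t • B.distVec z ξ ζ := by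
  refine Prod.ext ?_ (Prod.ext ?_ (Prod.ext rfl ?_))
  · change Matrix.of z.1 * hat (t • ξ) = t • (Matrix.of z.1 * hat ξ)
    rw [hat_smul, Matrix.mul_smul]
  · simp only [distVec, Matrix.mulVec_smul, Prod.smul_snd, Prod.smul_fst, smul_comm t]
  · simp only [distVec, map_smul, LinearMap.smul_apply, omega_smul, ← smul_add,
      Matrix.mulVec_smul, Prod.smul_snd, smul_comm t]

/-- The part of `momentumVel` that comes from the motion of `γ`. -/
def momentumDrift (B : Body) (b : ℝ) (γ Ω : R3) : R3 →ₗ[ℝ] R3 where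
  toFun ξ := (B.mass * B.r ^ 2 * b) • ((γ ⬝ᵥ (ξ ⨯₃ Ω)) • γ - (γ ⬝ᵥ Ω) • (ξ ⨯₃ γ))
  map_add' ξ η := by
    ext i
    simp only [map_add, LinearMap.add_apply, dotProduct_add, Pi.add_apply, Pi.sub_apply,
      Pi.smul_apply, smul_eq_mul]
    ring
  map_smul' t ξ := by
    ext i
    simp only [map_smul, LinearMap.smul_apply, dotProduct_smul, Pi.sub_apply, Pi.smul_apply,
      smul_eq_mul, RingHom.id_apply]
    ring

/-- The vectors of `𝓒`, in terms of the body angular velocity `ξ` and the velocity `κ` of the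
kinetic momentum. -/
def hamLift (B : Body) (a b : ℝ) (z : Phase) : R3 × R3 →ₗ[ℝ] Phase where
  toFun x := B.distVec z x.1 (B.inertia * B.velocityOf a b (poissonVector z)
    (x.2 - B.momentumDrift b (poissonVector z) (B.omega z.2.2.1) x.1))
  map_add' x y := by
    rw [← distVec_add, ← mul_add, ← velocityOf_add, Prod.fst_add, Prod.snd_add, map_add,
      add_sub_add_comm]
  map_smul' t x := by
    rw [RingHom.id_apply, ← distVec_smul, ← mul_smul_comm, ← velocityOf_smul, Prod.smul_fst,
      Prod.smul_snd, map_smul, smul_sub]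

theorem omega_inertia_mul (hI : ∀ i, 0 < B.inertia i) (Ω : R3) : B.omega (B.inertia * Ω) = Ω :=
  funext fun i => mul_div_cancel_left₀ (Ω i) (hI i).ne'

/-- The lift subtracts the drift and inverts `momentumOf` exactly so that `K` moves with the
prescribed velocity. -/
theorem IsCoupled.momentumVel_hamLift (h : B.IsCoupled a b) (hI : ∀ i, 0 < B.inertia i)
    (hm : 0 < B.mass) {z : Phase} (hz : z ∈ B.constraintSpace) (x : R3 × R3) :
    B.momentumVel a b (poissonVector z) (B.omega z.2.2.1) x.1 (B.omega (B.inertia *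
      B.velocityOf a b (poissonVector z)
        (x.2 - B.momentumDrift b (poissonVector z) (B.omega z.2.2.1) x.1))) = x.2 := by
  rw [omega_inertia_mul hI, momentumVel, h.momentumOf_velocityOf hI hm
    (poissonVector_dot_self ((mem_constraintSpace_iff hI z).1 hz).1)]
  exact sub_add_cancel _ _

theorem IsCoupled.mem_distributionC_iff_hamLift (h : B.IsCoupled a b) (hI : ∀ i, 0 < B.inertia i)
    (hm : 0 < B.mass) {z : Phase} (hz : z ∈ B.constraintSpace) (Z : Phase) :
    Z ∈ B.distributionC z ↔ ∃ x, Z = B.hamLift a b z x := by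
  rw [mem_distributionC_iff hI hz]
  constructor
  · rintro ⟨ξ, ζ, rfl⟩
    refine ⟨(ξ, B.momentumVel a b (poissonVector z) (B.omega z.2.2.1) ξ (B.omega ζ)), ?_⟩
    change _ = B.distVec z ξ (B.inertia * B.velocityOf a b (poissonVector z)
      (B.momentumOf a b (poissonVector z) (B.omega ζ)
        + B.momentumDrift b (poissonVector z) (B.omega z.2.2.1) ξ
        - B.momentumDrift b (poissonVector z) (B.omega z.2.2.1) ξ))
    rw [add_sub_cancel_right, h.velocityOf_momentumOf hI hm
      (poissonVector_dot_self ((mem_constraintSpace_iff hI z).1 hz).1), inertia_mul_omega hI]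
  · rintro ⟨x, rfl⟩
    exact ⟨_, _, rfl⟩

/-- In these coordinates nondegeneracy is visible: `ξ` and `κ` are paired by the dot product, and
the gyroscopic term only involves the `ξ` components. -/
theorem IsCoupled.canonicalForm_hamLift (h : B.IsCoupled a b) (hI : ∀ i, 0 < B.inertia i)
    (hm : 0 < B.mass) {z : Phase} (hz : z ∈ B.constraintSpace) (x y : R3 × R3) :
    canonicalForm z (B.hamLift a b z x) (B.hamLift a b z y) =
      y.2 ⬝ᵥ x.1 - x.2 ⬝ᵥ y.1
        + B.gyroVector a b (poissonVector z) (B.kineticMomentum z) ⬝ᵥ (x.1 ⨯₃ y.1) := by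
  change canonicalForm z (B.distVec z _ _) (B.distVec z _ _) = _
  rw [h.canonicalForm_distVec hI hm hz, h.momentumVel_hamLift hI hm hz,
    h.momentumVel_hamLift hI hm hz]

theorem IsCoupled.fderiv_poisson_kinetic_hamLift (h : B.IsCoupled a b) (hI : ∀ i, 0 < B.inertia i)
    (hm : 0 < B.mass) {z : Phase} (hz : z ∈ B.constraintSpace) (x : R3 × R3) :
    fderiv ℝ (fun z' => (poissonVector z', B.kineticMomentum z')) z (B.hamLift a b z x) =
      (poissonVector z ⨯₃ x.1, x.2) := by
  change fderiv ℝ _ z (B.distVec z _ _) = _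
  rw [h.fderiv_poisson_kinetic_distVec hI hz, h.momentumVel_hamLift hI hm hz]

/-! ### Almost Hamiltonian vectors and the nonholonomic bracket -/

/-- The coordinates of the almost Hamiltonian vector of a function whose differential on `𝓒` is
`α · ξ + β · κ`. -/
def hamCoord (B : Body) (a b : ℝ) (z : Phase) (α β : R3) : R3 × R3 :=
  (β, B.gyroVector a b (poissonVector z) (B.kineticMomentum z) ⨯₃ β - α)

theorem IsCoupled.isHamVec_iff (h : B.IsCoupled a b) (hI : ∀ i, 0 < B.inertia i)
    (hm : 0 < B.mass) {f : B.constraintSpace → ℝ} {z : B.constraintSpace} {F : Phase → ℝ}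
    (hF : LocallyExtends F f (z : Phase)) {α β : R3}
    (hd : ∀ x, fderiv ℝ F z (B.hamLift a b z x) = α ⬝ᵥ x.1 + β ⬝ᵥ x.2) (X : Phase) :
    B.IsHamVec f z X ↔ X = B.hamLift a b z (B.hamCoord a b z α β) := by
  have hmem := h.mem_distributionC_iff_hamLift hI hm z.2
  have hform := h.canonicalForm_hamLift hI hm z.2
  constructor
  · rintro ⟨hX, hdf⟩
    obtain ⟨x, rfl⟩ := (hmem X).1 hX
    have key : ∀ y : R3 × R3, y.2 ⬝ᵥ x.1 - x.2 ⬝ᵥ y.1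
        + B.gyroVector a b (poissonVector z) (B.kineticMomentum z) ⬝ᵥ (x.1 ⨯₃ y.1) =
        α ⬝ᵥ y.1 + β ⬝ᵥ y.2 := by
      intro y
      have hY := (hmem (B.hamLift a b z y)).2 ⟨y, rfl⟩
      obtain ⟨c, hc⟩ := hY.1
      rw [← hform, hdf _ hY c hc, hF.deriv_comp hc, hd]
    -- Pure `κ` directions determine the `ξ` component; pure `ξ` directions then determine the `κ`
    -- component.
    have h1 : x.1 = β := funext fun i => by
      simpa using key (0, Pi.single i 1)
    have h2 : x.2 = B.gyroVector a b (poissonVector z) (B.kineticMomentum z) ⨯₃ β - α := by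
      generalize B.gyroVector a b (poissonVector z) (B.kineticMomentum z) = V at *
      funext i
      have := key (Pi.single i 1, 0)
      rw [triple_product_permutation, triple_product_permutation] at this
      simp only [zero_dotProduct, dotProduct_zero, single_dotProduct, dotProduct_single, h1] at this
      simp only [Pi.sub_apply]
      linarith
    exact congrArg _ (Prod.ext h1 h2)
  · rintro rfl
    refine ⟨(hmem _).2 ⟨_, rfl⟩, fun Y hY c hc => ?_⟩
    obtain ⟨y, rfl⟩ := (hmem Y).1 hY
    rw [hform, hF.deriv_comp hc, hd, hamCoord]
    simp only [dot_three, cross_zero, cross_one, cross_two, Pi.sub_apply]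
    ring

theorem IsCoupled.existsUnique_isHamVec (h : B.IsCoupled a b) (hI : ∀ i, 0 < B.inertia i)
    (hm : 0 < B.mass) {f : B.constraintSpace → ℝ} (hf : SmoothFun f) (z : B.constraintSpace) :
    ∃! X : Phase, B.IsHamVec f z X := by
  obtain ⟨F, hF⟩ := hf z
  have hd := linearMap_apply_eq ((fderiv ℝ F z : Phase →ₗ[ℝ] ℝ) ∘ₗ B.hamLift a b z)
  exact ⟨_, (h.isHamVec_iff hI hm hF hd _).2 rfl, fun X => (h.isHamVec_iff hI hm hF hd X).1⟩

theorem IsCoupled.hamVec_eq (h : B.IsCoupled a b) (hI : ∀ i, 0 < B.inertia i)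
    (hm : 0 < B.mass) {f : B.constraintSpace → ℝ} {z : B.constraintSpace} {F : Phase → ℝ}
    (hF : LocallyExtends F f (z : Phase)) {α β : R3}
    (hd : ∀ x, fderiv ℝ F z (B.hamLift a b z x) = α ⬝ᵥ x.1 + β ⬝ᵥ x.2) :
    B.hamVec f z = B.hamLift a b z (B.hamCoord a b z α β) :=
  (h.isHamVec_iff hI hm hF hd _).1
    (Classical.epsilon_spec ⟨_, (h.isHamVec_iff hI hm hF hd _).2 rfl⟩)

/-- The chain rule with `(γ̇, K̇) = (γ × ξ, κ)`, followed by `∂F/∂γ · (γ × ξ) = (∂F/∂γ × γ) · ξ`. -/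
theorem IsCoupled.fderiv_comp_hamLift (h : B.IsCoupled a b) (hI : ∀ i, 0 < B.inertia i)
    (hm : 0 < B.mass) {z : Phase} (hz : z ∈ B.constraintSpace) {F : R3 × R3 → ℝ}
    (hF : DifferentiableAt ℝ F (poissonVector z, B.kineticMomentum z)) (x : R3 × R3) :
    fderiv ℝ (fun z' => F (poissonVector z', B.kineticMomentum z')) z (B.hamLift a b z x) =
      (gradγ F (poissonVector z, B.kineticMomentum z) ⨯₃ poissonVector z) ⬝ᵥ x.1
        + gradK F (poissonVector z, B.kineticMomentum z) ⬝ᵥ x.2 := by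
  have hπ := (contDiff_poisson_kinetic B).differentiable (by simp) z
  have hc : HasFDerivAt (fun z' => F (poissonVector z', B.kineticMomentum z')) _ z :=
    HasFDerivAt.comp z (g := F) hF.hasFDerivAt hπ.hasFDerivAt
  rw [hc.fderiv, ContinuousLinearMap.comp_apply,
    h.fderiv_poisson_kinetic_hamLift hI hm hz]
  have e := linearMap_apply_eq (fderiv ℝ F (poissonVector z, B.kineticMomentum z) :
    R3 × R3 →ₗ[ℝ] ℝ) (poissonVector z ⨯₃ x.1, x.2)
  change fderiv ℝ F _ _ = gradγ F _ ⬝ᵥ (poissonVector z ⨯₃ x.1) + gradK F _ ⬝ᵥ x.2 at e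
  rw [e]
  simp only [dot_three, cross_zero, cross_one, cross_two]
  ring

theorem locallyExtends_comp_poisson_kinetic {f : B.constraintSpace → ℝ} {F : R3 × R3 → ℝ}
    {k : levelSet → ℝ} {z : Phase} (hF : LocallyExtends F k (poissonVector z, B.kineticMomentum z))
    (hk : ∀ (z' : B.constraintSpace) (y : levelSet),
      (y : R3 × R3) = (poissonVector z', B.kineticMomentum z') → k y = f z')
    (hI : ∀ i, 0 < B.inertia i) :
    LocallyExtends (fun z' => F (poissonVector z', B.kineticMomentum z')) f z := by
  obtain ⟨U, hU, hx, hF, hf⟩ := hF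
  refine ⟨_, hU.preimage (contDiff_poisson_kinetic B).continuous, hx,
    hF.comp (contDiff_poisson_kinetic B).contDiffOn fun _ h => h, fun z' hz' => ?_⟩
  have hy : (poissonVector z', B.kineticMomentum z') ∈ levelSet :=
    poissonVector_dot_self ((mem_constraintSpace_iff hI z').1 z'.2).1
  rw [← hk z' ⟨_, hy⟩ rfl]
  exact hf ⟨_, hy⟩ hz'

/-- The nonholonomic bracket of functions of the Poisson vector and the kinetic momentum. -/
theorem IsCoupled.nhBracket_eq (h : B.IsCoupled a b) (hI : ∀ i, 0 < B.inertia i)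
    (hm : 0 < B.mass) {f g : B.constraintSpace → ℝ} {z : B.constraintSpace} {F G : R3 × R3 → ℝ}
    (hF : LocallyExtends (fun z' => F (poissonVector z', B.kineticMomentum z')) f (z : Phase))
    (hG : LocallyExtends (fun z' => G (poissonVector z', B.kineticMomentum z')) g (z : Phase))
    (hF' : DifferentiableAt ℝ F (poissonVector z, B.kineticMomentum z))
    (hG' : DifferentiableAt ℝ G (poissonVector z, B.kineticMomentum z)) {j : ℕ}
    (hj : ∀ γ K, B.bracketVector j γ K = B.gyroVector a b γ K) :
    B.nhBracket f g z = B.rankBracket j F G (poissonVector z, B.kineticMomentum z) := by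
  rw [nhBracket, h.hamVec_eq hI hm hF (h.fderiv_comp_hamLift hI hm z.2 hF'),
    h.hamVec_eq hI hm hG (h.fderiv_comp_hamLift hI hm z.2 hG'),
    h.canonicalForm_hamLift hI hm z.2, rankBracket, hj]
  -- The triple product `V · (∂F/∂K × ∂G/∂K)` occurs with signs `-1, -1, +1`: twice from the `κ`
  -- components and once from the gyroscopic term.
  simp only [hamCoord, dot_three, cross_zero, cross_one, cross_two, Pi.sub_apply]
  ring

end Body

/-! ### Generalized rolling matrices -/

/-- The squares of `C₁₁ - C₀₀` and `C₀₁ + C₁₀` sum to the squared Frobenius norm minus twice the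
determinant, that is `2 - 2 = 0`. -/
theorem mem_SO2_entries {C : Matrix (Fin 2) (Fin 2) ℝ}
    (hC : C ∈ Matrix.specialOrthogonalGroup (Fin 2) ℝ) :
    C 1 1 = C 0 0 ∧ C 0 1 = -C 1 0 ∧ C 0 0 ^ 2 + C 1 0 ^ 2 = 1 := by
  rw [Matrix.mem_specialOrthogonalGroup_iff, Matrix.mem_orthogonalGroup_iff',
    Matrix.det_fin_two] at hC
  obtain ⟨h1, h2⟩ := hC
  have e00 := congrFun (congrFun h1 0) 0
  have e11 := congrFun (congrFun h1 1) 1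
  simp [Matrix.mul_apply] at e00 e11
  have hs : (C 1 1 - C 0 0) ^ 2 + (C 0 1 + C 1 0) ^ 2 = 0 := by
    linear_combination e00 + e11 - 2 * h2
  have ha : C 1 1 - C 0 0 = 0 := by nlinarith [sq_nonneg (C 1 1 - C 0 0), sq_nonneg (C 0 1 + C 1 0)]
  have hb : C 0 1 + C 1 0 = 0 := by nlinarith [sq_nonneg (C 1 1 - C 0 0), sq_nonneg (C 0 1 + C 1 0)]
  exact ⟨by linarith, by linarith, by linarith⟩

theorem transpose_mulVec_e3 {h : Mat3} (hh : h ∈ Matrix.specialOrthogonalGroup (Fin 3) ℝ)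
    (he : h *ᵥ e3 = e3) : hᵀ *ᵥ e3 = e3 := by
  conv_lhs => rw [← he]
  rw [Matrix.mulVec_mulVec, transpose_mul_self_of_mem hh, Matrix.one_mulVec]

/-- A rotation about the third axis. -/
theorem exists_eq_of_mulVec_e3 {h : Mat3} (hh : h ∈ Matrix.specialOrthogonalGroup (Fin 3) ℝ)
    (he : h *ᵥ e3 = e3) : ∃ p q : ℝ, h = !![p, -q, 0; q, p, 0; 0, 0, 1] := by
  have c : ∀ i, h i 2 = e3 i := fun i => by
    rw [← he]; simp [mulVec_three, e3]
  have r : ∀ i, h 2 i = e3 i := fun i => by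
    rw [← transpose_mulVec_e3 hh he]; simp [mulVec_three, e3]
  have c0 : h 0 2 = 0 := c 0
  have c1 : h 1 2 = 0 := c 1
  have r0 : h 2 0 = 0 := r 0
  have r1 : h 2 1 = 0 := r 1
  have r2 : h 2 2 = 1 := r 2
  obtain ⟨h1, h2⟩ := mem_SO3_iff.1 hh
  have e00 := congrFun (congrFun h1 0) 0
  have e11 := congrFun (congrFun h1 1) 1
  rw [Matrix.det_fin_three] at h2
  simp [Matrix.mul_apply, Fin.sum_univ_three, c0, c1, r0, r1, r2] at e00 e11 h2
  -- The upper left block is a planar rotation, so the sum of squares from `mem_SO2_entries`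
  -- vanishes again.
  have hs : (h 1 1 - h 0 0) ^ 2 + (h 0 1 + h 1 0) ^ 2 = 0 := by
    linear_combination e00 + e11 - 2 * h2
  have ha : h 1 1 - h 0 0 = 0 := by nlinarith [sq_nonneg (h 1 1 - h 0 0), sq_nonneg (h 0 1 + h 1 0)]
  have hb : h 0 1 + h 1 0 = 0 := by nlinarith [sq_nonneg (h 1 1 - h 0 0), sq_nonneg (h 0 1 + h 1 0)]
  refine ⟨h 0 0, h 1 0, ?_⟩
  ext i j
  fin_cases i <;> fin_cases j <;> simp [c0, c1, r0, r1, r2] <;> linarith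

/-- Both matrices are block diagonal, and planar rotations commute with each other and with zero.
This is why the symmetry group must fix `e₃`. -/
theorem IsGeneralizedRolling.commute {A h : Mat3} (hA : IsGeneralizedRolling A)
    (hh : h ∈ Matrix.specialOrthogonalGroup (Fin 3) ℝ) (he : h *ᵥ e3 = e3) : h * A = A * h := by
  obtain ⟨p, q, rfl⟩ := exists_eq_of_mulVec_e3 hh he
  rcases hA with ⟨-, C, hC, rfl⟩ | ⟨-, C, hC, rfl⟩ | ⟨-, rfl⟩ | ⟨-, rfl⟩
  · obtain ⟨h1, h2, -⟩ := mem_SO2_entries hC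
    ext i j
    fin_cases i <;> fin_cases j <;>
      simp [Matrix.mul_apply, Fin.sum_univ_three, h1, h2] <;> ring
  · obtain ⟨h1, h2, -⟩ := mem_SO2_entries hC
    ext i j
    fin_cases i <;> fin_cases j <;>
      simp [Matrix.mul_apply, Fin.sum_univ_three, h1, h2] <;> ring
  · ext i j
    fin_cases i <;> fin_cases j <;>
      simp [Matrix.mul_apply, Fin.sum_univ_three, e3]
  · simp

theorem inv_mulVec_of_diagonal {d : R3} (hd : ∀ i, d i ≠ 0) (v : R3) :
    (Matrix.diagonal d)⁻¹ *ᵥ v = v / d := by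
  have : (Matrix.diagonal d)⁻¹ = Matrix.diagonal fun i => (d i)⁻¹ :=
    Matrix.inv_eq_right_inv (by
      rw [Matrix.diagonal_mul_diagonal, ← Matrix.diagonal_one]
      exact congrArg _ (funext fun i => mul_inv_cancel₀ (hd i)))
  rw [this]
  ext i
  rw [Matrix.mulVec_diagonal, Pi.div_apply, div_eq_inv_mul]

namespace Body

variable {B : Body} {a b : ℝ}

theorem inertiaTensor_inv_mulVec (hI : ∀ i, 0 < B.inertia i) (v : R3) :
    B.inertiaTensor⁻¹ *ᵥ v = v / B.shiftedInertia 0 := by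
  rw [inertiaTensor, inv_mulVec_of_diagonal fun i => (hI i).ne']
  congr 1
  funext i
  simp [shiftedInertia]

theorem totalInertia_inv_mulVec (hI : ∀ i, 0 < B.inertia i) (hm : 0 < B.mass) (v : R3) :
    B.totalInertia⁻¹ *ᵥ v = v / B.shiftedInertia 1 := by
  have e : B.totalInertia = Matrix.diagonal (B.shiftedInertia 1) := by
    rw [totalInertia, inertiaTensor, ← Matrix.diagonal_one, ← Matrix.diagonal_smul,
      Matrix.diagonal_add]
    congr 1
  rw [e, inv_mulVec_of_diagonal fun i => (shiftedInertia_pos hI hm zero_le_one i).ne']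

/-- In every rank the bracket is governed by the two coefficients of `Aᵀ A`. -/
theorem exists_isCoupled (hI : ∀ i, 0 < B.inertia i) (hm : 0 < B.mass)
    (hA : IsGeneralizedRolling B.A) : ∃ a b, B.IsCoupled a b ∧
      ∀ γ K, B.bracketVector B.A.rank γ K = B.gyroVector a b γ K := by
  rcases hA with ⟨hr, C, hC, hA⟩ | ⟨hr, C, hC, hA⟩ | ⟨hr, hA⟩ | ⟨hr, hA⟩
  · obtain ⟨h1, h2, h3⟩ := mem_SO2_entries hC
    refine ⟨1, 0, ⟨?_, zero_le_one, Or.inl le_rfl⟩, fun γ K => ?_⟩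
    · rw [hA]
      ext i j
      fin_cases i <;> fin_cases j <;>
        simp [Matrix.mul_apply, Fin.sum_univ_three, h1, h2] <;> linarith
    · rw [hr]
      simp [bracketVector, angVel, gyroVector, velocityOf, totalInertia_inv_mulVec hI hm]
  · obtain ⟨h1, h2, h3⟩ := mem_SO2_entries hC
    -- `AᵀA` is the projection `E - e₃e₃ᵀ` onto the horizontal plane.
    refine ⟨1, -1, ⟨?_, zero_le_one, Or.inr ⟨rfl, rfl⟩⟩, fun γ K => ?_⟩
    · rw [hA]
      ext i j
      fin_cases i <;> fin_cases j <;>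
        simp [Matrix.mul_apply, Fin.sum_univ_three, h1, h2, e3] <;> linarith
    · rw [hr]
      simp [bracketVector, angVel, gyroVector, velocityOf, totalInertia_inv_mulVec hI hm,
        sub_eq_add_neg]
  · refine ⟨0, 1, ⟨?_, le_rfl, Or.inl zero_le_one⟩, fun γ K => ?_⟩
    · rw [hA]
      ext i j
      fin_cases i <;> fin_cases j <;>
        simp [Matrix.mul_apply, Fin.sum_univ_three, e3]
    · rw [hr]
      simp [bracketVector, angVel, gyroVector, velocityOf, inertiaTensor_inv_mulVec hI]
  · refine ⟨0, 0, ⟨?_, le_rfl, Or.inl le_rfl⟩, fun γ K => ?_⟩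
    · rw [hA]
      simp
    · rw [hr]
      simp [bracketVector, gyroVector]

/-! ### Reduction -/

/-- The lift fixes `M` and rotates `p` by `h`, which passes through `A` in the graph equation. -/
theorem cotangentLift_mem (hI : ∀ i, 0 < B.inertia i) (hA : IsGeneralizedRolling B.A) {s : SE3}
    (hs : s ∈ symmetryGroup) {z : Phase} (hz : z ∈ B.constraintSpace) :
    s.cotangentLift z ∈ B.constraintSpace := by
  obtain ⟨hg, hp⟩ := (mem_constraintSpace_iff hI z).1 hz
  refine (mem_constraintSpace_iff hI _).2 ⟨mul_mem s.rot.2 hg, ?_⟩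
  change (s.rot : Mat3) *ᵥ z.2.2.2 =
    (B.mass * B.r) • (B.A *ᵥ (((s.rot : Mat3) * Matrix.of z.1) *ᵥ B.omega z.2.2.1))
  rw [hp, Matrix.mulVec_smul, Matrix.mulVec_mulVec _ (s.rot : Mat3), hA.commute s.rot.2 hs,
    ← Matrix.mulVec_mulVec, Matrix.mulVec_mulVec _ (s.rot : Mat3)]

theorem poissonVector_cotangentLift {s : SE3} (hs : s ∈ symmetryGroup) (z : Phase) :
    poissonVector (s.cotangentLift z) = poissonVector z := by
  change ((s.rot : Mat3) * Matrix.of z.1)ᵀ *ᵥ e3 = (Matrix.of z.1)ᵀ *ᵥ e3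
  rw [Matrix.transpose_mul, ← Matrix.mulVec_mulVec, transpose_mulVec_e3 s.rot.2 hs]

variable (B) in
/-- The Poisson vector and the kinetic momentum, as a map from `𝓜` to the level set. -/
def toLevelSet (hI : ∀ i, 0 < B.inertia i) (z : B.constraintSpace) : levelSet :=
  ⟨(poissonVector z, B.kineticMomentum z),
    poissonVector_dot_self ((mem_constraintSpace_iff hI z).1 z.2).1⟩

/-- Equal `(γ, K)` forces equal `Ω`, hence equal `M`. The rotation `g' gᵀ` fixes `e₃` because `g γ =
e₃ = g' γ`, a translation matches `x`, and `p` agrees by the graph equation. -/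
theorem IsCoupled.toLevelSet_eq_iff (h : B.IsCoupled a b) (hI : ∀ i, 0 < B.inertia i)
    (hm : 0 < B.mass) (hA : IsGeneralizedRolling B.A) (z z' : B.constraintSpace) :
    B.toLevelSet hI z = B.toLevelSet hI z' ↔ B.orbitSetoid.r z z' := by
  obtain ⟨hg, hp⟩ := (mem_constraintSpace_iff hI _).1 z.2
  obtain ⟨hg', hp'⟩ := (mem_constraintSpace_iff hI _).1 z'.2
  constructor
  · intro he
    have hγ : poissonVector (z : Phase) = poissonVector (z' : Phase) :=
      congrArg (fun y : levelSet => (y : R3 × R3).1) he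
    have hK : B.kineticMomentum z = B.kineticMomentum z' :=
      congrArg (fun y : levelSet => (y : R3 × R3).2) he
    have hΩ : B.omega (z : Phase).2.2.1 = B.omega (z' : Phase).2.2.1 := by
      rw [← h.velocityOf_kineticMomentum hI hm z.2, ← h.velocityOf_kineticMomentum hI hm z'.2,
        hγ, hK]
    have hM : (z : Phase).2.2.1 = (z' : Phase).2.2.1 := by
      rw [← inertia_mul_omega hI (z : Phase).2.2.1, hΩ, inertia_mul_omega hI]
    have hgt : (Matrix.of (z : Phase).1)ᵀ ∈ Matrix.specialOrthogonalGroup (Fin 3) ℝ :=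
      mem_SO3_iff.2 ⟨by rw [Matrix.transpose_transpose, mul_transpose_self_of_mem hg],
        by rw [Matrix.det_transpose, (mem_SO3_iff.1 hg).2]⟩
    let h0 : Matrix.specialOrthogonalGroup (Fin 3) ℝ := ⟨_, mul_mem hg' hgt⟩
    have hh0 : (h0 : Mat3) * Matrix.of (z : Phase).1 = Matrix.of (z' : Phase).1 := by
      rw [mul_assoc, transpose_mul_self_of_mem hg, mul_one]
    let s : SE3 := ⟨h0, (z' : Phase).2.1 - (h0 : Mat3) *ᵥ (z : Phase).2.1⟩
    have hs : s ∈ symmetryGroup := by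
      change (Matrix.of (z' : Phase).1 * (Matrix.of (z : Phase).1)ᵀ) *ᵥ e3 = e3
      rw [← Matrix.mulVec_mulVec]
      change Matrix.of (z' : Phase).1 *ᵥ poissonVector z = e3
      rw [hγ, poissonVector, Matrix.mulVec_mulVec, mul_transpose_self_of_mem hg',
        Matrix.one_mulVec]
    refine ⟨s, hs, Prod.ext hh0 (Prod.ext ?_ (Prod.ext hM ?_))⟩
    · exact add_sub_cancel _ _
    · have := ((mem_constraintSpace_iff hI _).1 (cotangentLift_mem hI hA hs z.2)).2
      rw [this, hp', ← hΩ, ← hh0]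
      rfl
  · rintro ⟨s, hs, he⟩
    have hγ : poissonVector (z : Phase) = poissonVector (z' : Phase) := by
      rw [← he, poissonVector_cotangentLift hs]
    have hM : (z : Phase).2.2.1 = (z' : Phase).2.2.1 := by rw [← he]; rfl
    refine Subtype.ext (Prod.ext hγ ?_)
    change B.kineticMomentum z = B.kineticMomentum z'
    rw [h.kineticMomentum_eq hI z.2, h.kineticMomentum_eq hI z'.2, hγ, hM]

variable (B) in
/-- A local section of `toLevelSet`. -/
def levelSection (a b σ : ℝ) (y : R3 × R3) : Phase :=
  (Matrix.of.symm (frame σ y.1), 0, B.inertia * B.velocityOf a b y.1 y.2,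
    (B.mass * B.r) • (B.A *ᵥ (frame σ y.1 *ᵥ B.velocityOf a b y.1 y.2)))

theorem levelSection_mem (hI : ∀ i, 0 < B.inertia i) {σ : ℝ} (hσ : σ ^ 2 = 1) {y : R3 × R3}
    (hy : y ∈ levelSet) (h : 1 + σ * y.1 2 ≠ 0) : B.levelSection a b σ y ∈ B.constraintSpace := by
  refine (mem_constraintSpace_iff hI _).2 ⟨frame_mem hσ hy h, ?_⟩
  simp only [levelSection, omega_inertia_mul hI, Equiv.apply_symm_apply]

theorem IsCoupled.poisson_kinetic_levelSection (h : B.IsCoupled a b) (hI : ∀ i, 0 < B.inertia i)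
    (hm : 0 < B.mass) {σ : ℝ} (hσ : σ ^ 2 = 1) {y : R3 × R3}
    (hy : y ∈ levelSet) (hn : 1 + σ * y.1 2 ≠ 0) :
    (poissonVector (B.levelSection a b σ y), B.kineticMomentum (B.levelSection a b σ y)) = y := by
  have hγ : poissonVector (B.levelSection a b σ y) = y.1 := frame_transpose_mulVec σ y.1
  rw [h.kineticMomentum_eq hI (levelSection_mem hI hσ hy hn), hγ]
  refine Prod.ext rfl ?_
  simp only [levelSection, omega_inertia_mul hI]
  exact h.momentumOf_velocityOf hI hm hy y.2

/-- The two charts of `frame` cover the sphere. -/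
theorem exists_sign (t : ℝ) : ∃ σ : ℝ, σ ^ 2 = 1 ∧ 1 + σ * t ≠ 0 := by
  by_cases h : 1 + 1 * t = 0
  · exact ⟨-1, by norm_num, by linarith⟩
  · exact ⟨1, by norm_num, h⟩

/-! ### Smoothness of the section and of the explicit bracket -/

variable (B) in
/-- The open set on which `velocityOf` is smooth. -/
def regularSet (a b : ℝ) : Set (R3 × R3) :=
  {y | y.1 ⬝ᵥ y.1 + B.mass * B.r ^ 2 * b * (y.1 ⬝ᵥ (y.1 / B.shiftedInertia a)) ≠ 0}

theorem contDiff_dotProduct {E : Type*} [NormedAddCommGroup E] [NormedSpace ℝ E] {u v : E → R3}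
    (hu : ContDiff ℝ ∞ u) (hv : ContDiff ℝ ∞ v) : ContDiff ℝ ∞ fun y => u y ⬝ᵥ v y := by
  simp only [dot_three]; fun_prop

theorem contDiffOn_dotProduct {E : Type*} [NormedAddCommGroup E] [NormedSpace ℝ E] {u v : E → R3}
    {s : Set E} (hu : ContDiffOn ℝ ∞ u s) (hv : ContDiffOn ℝ ∞ v s) :
    ContDiffOn ℝ ∞ (fun y => u y ⬝ᵥ v y) s := by
  simp only [dot_three]; fun_prop

theorem contDiffOn_cross {E : Type*} [NormedAddCommGroup E] [NormedSpace ℝ E] {u v : E → R3}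
    {s : Set E} (hu : ContDiffOn ℝ ∞ u s) (hv : ContDiffOn ℝ ∞ v s) :
    ContDiffOn ℝ ∞ (fun y => u y ⨯₃ v y) s := by
  refine contDiffOn_pi.2 fun i => ?_
  fin_cases i
  · simp only [Fin.zero_eta, cross_zero]; fun_prop
  · simp only [Fin.mk_one, cross_one]; fun_prop
  · simp only [Fin.reduceFinMk, cross_two]; fun_prop

theorem contDiff_div_shiftedInertia {E : Type*} [NormedAddCommGroup E] [NormedSpace ℝ E]
    {u : E → R3} (hu : ContDiff ℝ ∞ u) : ContDiff ℝ ∞ fun y => u y / B.shiftedInertia a :=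
  contDiff_pi.2 fun i => (contDiff_pi.1 hu i).div_const _

variable (B) in
theorem isOpen_regularSet (a b : ℝ) : IsOpen (B.regularSet a b) := by
  refine isOpen_ne_fun (ContDiff.continuous (𝕜 := ℝ) (n := ∞) ?_) continuous_const
  exact (contDiff_dotProduct contDiff_fst contDiff_fst).add
    (contDiff_const.mul (contDiff_dotProduct contDiff_fst
      (contDiff_div_shiftedInertia contDiff_fst)))

variable (B) in
theorem contDiffOn_velocityOf (a b : ℝ) :
    ContDiffOn ℝ ∞ (fun y : R3 × R3 => B.velocityOf a b y.1 y.2) (B.regularSet a b) := by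
  have hγ := contDiff_div_shiftedInertia (B := B) (a := a)
    (contDiff_fst : ContDiff ℝ ∞ (Prod.fst : R3 × R3 → R3))
  have hK := contDiff_div_shiftedInertia (B := B) (a := a)
    (contDiff_snd : ContDiff ℝ ∞ (Prod.snd : R3 × R3 → R3))
  refine hK.contDiffOn.sub (ContDiffOn.smul (contDiffOn_const.mul (ContDiffOn.div
    (contDiff_dotProduct contDiff_snd hγ).contDiffOn ?_ fun y hy => hy)) hγ.contDiffOn)
  exact ((contDiff_dotProduct contDiff_fst contDiff_fst).add
    (contDiff_const.mul (contDiff_dotProduct contDiff_fst hγ))).contDiffOn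

variable (B) in
theorem contDiffOn_gyroVector (a b : ℝ) :
    ContDiffOn ℝ ∞ (fun y : R3 × R3 => B.gyroVector a b y.1 y.2) (B.regularSet a b) := by
  have h := B.contDiffOn_velocityOf a b
  exact (contDiffOn_snd.add (contDiffOn_const (c := B.mass * B.r ^ 2 * a) |>.smul h)).add
    ((contDiffOn_const.mul (contDiffOn_dotProduct h contDiffOn_fst)).smul contDiffOn_fst)

theorem IsCoupled.levelSet_subset_regularSet (h : B.IsCoupled a b) (hI : ∀ i, 0 < B.inertia i)
    (hm : 0 < B.mass) : levelSet ⊆ B.regularSet a b := fun _ hy => (h.den_pos hI hm hy).ne'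

theorem contDiffOn_frame (σ : ℝ) (i j : Fin 3) :
    ContDiffOn ℝ ∞ (fun y : R3 × R3 => frame σ y.1 i j) {y | 1 + σ * y.1 2 ≠ 0} := by
  have h : ContDiffOn ℝ ∞ (fun y : R3 × R3 => (1 + σ * y.1 2)⁻¹) {y | 1 + σ * y.1 2 ≠ 0} :=
    ContDiffOn.inv (by fun_prop) fun y hy => hy
  fin_cases i <;> fin_cases j <;> simp [frame] <;> fun_prop

variable (B) in
theorem contDiffOn_levelSection (a b σ : ℝ) :
    ContDiffOn ℝ ∞ (B.levelSection a b σ) ({y | 1 + σ * y.1 2 ≠ 0} ∩ B.regularSet a b) := by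
  have hv := (B.contDiffOn_velocityOf a b).mono
    (Set.inter_subset_right (s := {y | 1 + σ * y.1 2 ≠ 0}))
  have hf : ∀ i j, ContDiffOn ℝ ∞ (fun y : R3 × R3 => frame σ y.1 i j)
      ({y | 1 + σ * y.1 2 ≠ 0} ∩ B.regularSet a b) := fun i j =>
    (contDiffOn_frame σ i j).mono Set.inter_subset_left
  refine ContDiffOn.prodMk ?_ (ContDiffOn.prodMk contDiffOn_const (ContDiffOn.prodMk ?_ ?_))
  · exact contDiffOn_pi.2 fun i => contDiffOn_pi.2 fun j => hf i j
  · exact contDiffOn_pi.2 fun i => contDiffOn_const.mul (contDiffOn_pi.1 hv i)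
  · refine contDiffOn_pi.2 fun i => contDiffOn_const.mul (ContDiffOn.sum (s := Finset.univ)
      fun j _ => contDiffOn_const.mul (ContDiffOn.sum (s := Finset.univ)
        fun k _ => (hf j k).mul (contDiffOn_pi.1 hv k)))

/-- Passing to `gyroVector` confines all denominators of the four ranks to the single condition
defining `regularSet`. -/
theorem contDiffOn_rankBracket {j : ℕ} (hj : ∀ γ K, B.bracketVector j γ K = B.gyroVector a b γ K)
    {F G : R3 × R3 → ℝ} {U : Set (R3 × R3)} (hU : IsOpen U) (hUr : U ⊆ B.regularSet a b)
    (hF : ContDiffOn ℝ ∞ F U) (hG : ContDiffOn ℝ ∞ G U) :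
    ContDiffOn ℝ ∞ (B.rankBracket j F G) U := by
  have hd : ∀ {H : R3 × R3 → ℝ}, ContDiffOn ℝ ∞ H U → ∀ v : R3 × R3,
      ContDiffOn ℝ ∞ (fun y => fderiv ℝ H y v) U := fun hH v =>
    (hH.fderiv_of_isOpen hU (by simp)).clm_apply contDiffOn_const
  have hγ : ∀ {H : R3 × R3 → ℝ}, ContDiffOn ℝ ∞ H U → ContDiffOn ℝ ∞ (gradγ H) U := fun hH =>
    contDiffOn_pi.2 fun i => hd hH _
  have hK : ∀ {H : R3 × R3 → ℝ}, ContDiffOn ℝ ∞ H U → ContDiffOn ℝ ∞ (gradK H) U := fun hH =>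
    contDiffOn_pi.2 fun i => hd hH _
  have e : B.rankBracket j F G = fun y =>
      -(B.gyroVector a b y.1 y.2 ⬝ᵥ (gradK F y ⨯₃ gradK G y))
        - y.1 ⬝ᵥ (gradK F y ⨯₃ gradγ G y - gradK G y ⨯₃ gradγ F y) :=
    funext fun y => by rw [rankBracket, hj]
  rw [e]
  exact (contDiffOn_dotProduct ((B.contDiffOn_gyroVector a b).mono hUr)
    (contDiffOn_cross (hK hF) (hK hG))).neg.sub (contDiffOn_dotProduct contDiffOn_fst
      ((contDiffOn_cross (hK hF) (hγ hG)).sub (contDiffOn_cross (hK hG) (hγ hF))))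

theorem rankBracket_casimir (B : Body) (j : ℕ) (F : R3 × R3 → ℝ) (y : R3 × R3) :
    B.rankBracket j F (fun y' => y'.1 ⬝ᵥ y'.1) y = 0 := by
  have hC : ContDiff ℝ ∞ fun y' : R3 × R3 => y'.1 ⬝ᵥ y'.1 :=
    contDiff_dotProduct contDiff_fst contDiff_fst
  have hd : ∀ v : R3 × R3, fderiv ℝ (fun y' : R3 × R3 => y'.1 ⬝ᵥ y'.1) y v = 2 * (y.1 ⬝ᵥ v.1) := by
    intro v
    refine HasDerivAt.unique ((hC.differentiable (by simp) y).hasFDerivAt.hasLineDerivAt v)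
      (hasDerivAt_of_quadratic (a := y.1 ⬝ᵥ y.1) (c := v.1 ⬝ᵥ v.1) fun s => ?_)
    simp only [dot_three, Prod.fst_add, Prod.smul_fst, Pi.add_apply, Pi.smul_apply, smul_eq_mul]
    ring
  have hγ : gradγ (fun y' : R3 × R3 => y'.1 ⬝ᵥ y'.1) y = (2 : ℝ) • y.1 := by
    funext i; rw [gradγ, hd]; simp
  have hK : gradK (fun y' : R3 × R3 => y'.1 ⬝ᵥ y'.1) y = 0 := by
    funext i; rw [gradK, hd]; simp
  -- Only a multiple of `γ · (∂F/∂K × γ)` is left.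
  rw [rankBracket, hγ, hK]
  simp only [dot_three, cross_zero, cross_one, cross_two, Pi.sub_apply, Pi.smul_apply,
    Pi.zero_apply, smul_eq_mul]
  ring

/-- The reduced space is in bijection with the level set. -/
theorem IsCoupled.exists_equiv (h : B.IsCoupled a b) (hI : ∀ i, 0 < B.inertia i)
    (hm : 0 < B.mass) (hA : IsGeneralizedRolling B.A) :
    ∃ Φ : B.ReducedSpace ≃ levelSet, ∀ z, Φ (B.orbitProj z) = B.toLevelSet hI z := by
  let φ : B.ReducedSpace → levelSet := Quotient.lift (B.toLevelSet hI) fun z z' hzz' =>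
    (h.toLevelSet_eq_iff hI hm hA z z').2 hzz'
  refine ⟨Equiv.ofBijective φ ⟨?_, fun y => ?_⟩, fun z => rfl⟩
  · rintro ⟨z⟩ ⟨z'⟩ he
    exact Quotient.sound ((h.toLevelSet_eq_iff hI hm hA z z').1 he)
  · obtain ⟨σ, hσ, hn⟩ := exists_sign ((y : R3 × R3).1 2)
    exact ⟨B.orbitProj ⟨_, levelSection_mem (a := a) (b := b) hI hσ y.2 hn⟩,
      Subtype.ext (h.poisson_kinetic_levelSection hI hm hσ y.2 hn)⟩

/-- An extension of `f ∘ ρ`, composed with a local section of `(γ, K)`, extends the function on the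
level set; the section itself is smooth on an open set of the ambient space. -/
theorem IsCoupled.smoothFun_comp_symm (h : B.IsCoupled a b) (hI : ∀ i, 0 < B.inertia i)
    (hm : 0 < B.mass) {Φ : B.ReducedSpace ≃ levelSet}
    (hΦ : ∀ z, Φ (B.orbitProj z) = B.toLevelSet hI z) {f : B.ReducedSpace → ℝ}
    (hf : B.SmoothRed f) : SmoothFun (f ∘ Φ.symm) := by
  intro y
  obtain ⟨σ, hσ, hn⟩ := exists_sign ((y : R3 × R3).1 2)
  obtain ⟨F, U, hU, hx, hF, hext⟩ := hf ⟨_, levelSection_mem (a := a) (b := b) hI hσ y.2 hn⟩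
  have hs := B.contDiffOn_levelSection a b σ
  have hW : IsOpen ({y : R3 × R3 | 1 + σ * y.1 2 ≠ 0} ∩ B.regularSet a b) :=
    (isOpen_ne_fun (by fun_prop) continuous_const).inter (B.isOpen_regularSet a b)
  refine ⟨fun y => F (B.levelSection a b σ y), _, hs.continuousOn.isOpen_inter_preimage hW hU,
    ⟨⟨hn, h.levelSet_subset_regularSet hI hm y.2⟩, hx⟩,
    hF.comp (hs.mono Set.inter_subset_left) fun _ hy => hy.2, fun y' hy' => ?_⟩
  have hm' := levelSection_mem (a := a) (b := b) hI hσ y'.2 hy'.1.1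
  refine (hext ⟨_, hm'⟩ hy'.2).trans (congrArg f (Φ.injective ?_))
  rw [Φ.apply_symm_apply, hΦ]
  exact Subtype.ext (h.poisson_kinetic_levelSection hI hm hσ y'.2 hy'.1.1)

theorem locallyExtends_orbitProj (hI : ∀ i, 0 < B.inertia i) {Φ : B.ReducedSpace ≃ levelSet}
    (hΦ : ∀ z, Φ (B.orbitProj z) = B.toLevelSet hI z) {f : B.ReducedSpace → ℝ}
    {F : R3 × R3 → ℝ} {z : B.constraintSpace}
    (hF : LocallyExtends F (f ∘ Φ.symm) (Φ (B.orbitProj z) : R3 × R3)) :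
    LocallyExtends (fun z' => F (poissonVector z', B.kineticMomentum z')) (f ∘ B.orbitProj)
      (z : Phase) := by
  rw [hΦ] at hF
  refine locallyExtends_comp_poisson_kinetic hF (fun z' y hy => congrArg f ?_) hI
  rw [Equiv.symm_apply_eq, hΦ]
  exact Subtype.ext hy

/-- The nonholonomic bracket of invariant functions, in terms of the explicit bracket. -/
theorem IsCoupled.nhBracket_orbitProj (h : B.IsCoupled a b) (hI : ∀ i, 0 < B.inertia i)
    (hm : 0 < B.mass) {Φ : B.ReducedSpace ≃ levelSet}
    (hΦ : ∀ z, Φ (B.orbitProj z) = B.toLevelSet hI z) {j : ℕ}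
    (hj : ∀ γ K, B.bracketVector j γ K = B.gyroVector a b γ K) {f g : B.ReducedSpace → ℝ}
    {F G : R3 × R3 → ℝ} {z : B.constraintSpace}
    (hF : LocallyExtends F (f ∘ Φ.symm) (Φ (B.orbitProj z) : R3 × R3))
    (hG : LocallyExtends G (g ∘ Φ.symm) (Φ (B.orbitProj z) : R3 × R3)) :
    B.nhBracket (f ∘ B.orbitProj) (g ∘ B.orbitProj) z =
      B.rankBracket j F G (Φ (B.orbitProj z)) := by
  have hF' := hF.differentiableAt
  have hG' := hG.differentiableAt
  have e1 := locallyExtends_orbitProj hI hΦ hF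
  have e2 := locallyExtends_orbitProj hI hΦ hG
  rw [hΦ] at hF' hG' ⊢
  exact h.nhBracket_eq hI hm e1 e2 hF' hG' hj

/-- The bracket at any representative is given by a formula in the orbit alone, so the choice made
by `Quotient.out` is immaterial. -/
theorem IsCoupled.redBracket_eq (h : B.IsCoupled a b) (hI : ∀ i, 0 < B.inertia i)
    (hm : 0 < B.mass) {Φ : B.ReducedSpace ≃ levelSet}
    (hΦ : ∀ z, Φ (B.orbitProj z) = B.toLevelSet hI z) {j : ℕ}
    (hj : ∀ γ K, B.bracketVector j γ K = B.gyroVector a b γ K) {f g : B.ReducedSpace → ℝ}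
    {F G : R3 × R3 → ℝ} {x : B.ReducedSpace}
    (hF : LocallyExtends F (f ∘ Φ.symm) (Φ x : R3 × R3))
    (hG : LocallyExtends G (g ∘ Φ.symm) (Φ x : R3 × R3)) :
    B.redBracket f g x = B.rankBracket j F G (Φ x) := by
  have hx : B.orbitProj (Quotient.out x) = x := Quotient.out_eq x
  rw [← hx] at hF hG
  have := h.nhBracket_orbitProj hI hm hΦ hj hF hG
  rwa [hx] at this

theorem IsCoupled.smoothRed_iff (h : B.IsCoupled a b) (hI : ∀ i, 0 < B.inertia i)
    (hm : 0 < B.mass) {Φ : B.ReducedSpace ≃ levelSet}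
    (hΦ : ∀ z, Φ (B.orbitProj z) = B.toLevelSet hI z) (f : B.ReducedSpace → ℝ) :
    B.SmoothRed f ↔ SmoothFun (f ∘ Φ.symm) := by
  refine ⟨h.smoothFun_comp_symm hI hm hΦ, fun hf z => ?_⟩
  obtain ⟨F, hF⟩ := hf (Φ (B.orbitProj z))
  exact ⟨_, locallyExtends_orbitProj hI hΦ hF⟩

/-- One pair of extensions serves all nearby points of the level set, so their explicit bracket is a
smooth extension of the reduced one. -/
theorem IsCoupled.smoothRed_redBracket (h : B.IsCoupled a b) (hI : ∀ i, 0 < B.inertia i)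
    (hm : 0 < B.mass) {Φ : B.ReducedSpace ≃ levelSet}
    (hΦ : ∀ z, Φ (B.orbitProj z) = B.toLevelSet hI z) {j : ℕ}
    (hj : ∀ γ K, B.bracketVector j γ K = B.gyroVector a b γ K) {f g : B.ReducedSpace → ℝ}
    (hf : B.SmoothRed f) (hg : B.SmoothRed g) : B.SmoothRed (B.redBracket f g) := by
  rw [h.smoothRed_iff hI hm hΦ] at hf hg ⊢
  intro y
  obtain ⟨F, U, hU, hyU, hF, hFe⟩ := hf y
  obtain ⟨G, W, hW, hyW, hG, hGe⟩ := hg y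
  refine ⟨B.rankBracket j F G, U ∩ W ∩ B.regularSet a b,
    (hU.inter hW).inter (B.isOpen_regularSet a b),
    ⟨⟨hyU, hyW⟩, h.levelSet_subset_regularSet hI hm y.2⟩,
    contDiffOn_rankBracket hj ((hU.inter hW).inter (B.isOpen_regularSet a b))
      Set.inter_subset_right (hF.mono fun _ h => h.1.1) (hG.mono fun _ h => h.1.2),
    fun y' hy' => ?_⟩
  have e := h.redBracket_eq hI hm hΦ hj (x := Φ.symm y') (f := f) (g := g) (F := F) (G := G)
    (by rw [Φ.apply_symm_apply]; exact ⟨U, hU, hy'.1.1, hF, hFe⟩)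
    (by rw [Φ.apply_symm_apply]; exact ⟨W, hW, hy'.1.2, hG, hGe⟩)
  rw [Φ.apply_symm_apply] at e
  exact e.symm

end Body

end RollingBody

end

theorem mainTheorem7 (B : Body) (hI : ∀ i, 0 < B.inertia i) (hm : 0 < B.mass)
    (hA : IsGeneralizedRolling B.A) :
    -- the nonholonomic bracket is well defined
    (∀ f : B.constraintSpace → ℝ, SmoothFun f → ∀ z, ∃! X : Phase, B.IsHamVec f z X) ∧
    -- the lifted action of the symmetry group leaves the constraint space invariant
    (∀ a ∈ symmetryGroup, ∀ z ∈ B.constraintSpace, a.cotangentLift z ∈ B.constraintSpace) ∧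
    -- the nonholonomic bracket descends to the reduced bracket, which is a bracket of smooth
    -- functions
    (∀ f g : B.ReducedSpace → ℝ, B.SmoothRed f → B.SmoothRed g →
      B.SmoothRed (B.redBracket f g) ∧
      ∀ z, B.redBracket f g (B.orbitProj z) =
        B.nhBracket (f ∘ B.orbitProj) (g ∘ B.orbitProj) z) ∧
    -- the square norm of the Poisson vector is a Casimir function of the explicit bracket
    (∀ (F : R3 × R3 → ℝ) (y : R3 × R3),
      B.rankBracket B.A.rank F (fun y' => y'.1 ⬝ᵥ y'.1) y = 0) ∧
    -- the reduced space is identified with the level set through the Poisson vector and the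
    -- kinetic momentum, and the reduced bracket is the restriction of the explicit bracket
    ∃ Φ : B.ReducedSpace ≃ levelSet,
      (∀ z : B.constraintSpace,
        (Φ (B.orbitProj z) : R3 × R3) = (Body.poissonVector z, B.kineticMomentum z)) ∧
      (∀ f : B.ReducedSpace → ℝ, B.SmoothRed f ↔ SmoothFun (f ∘ Φ.symm)) ∧
      ∀ f g : B.ReducedSpace → ℝ, B.SmoothRed f → B.SmoothRed g →
        ∀ (x : B.ReducedSpace) (F G : R3 × R3 → ℝ),
          LocallyExtends F (f ∘ Φ.symm) (Φ x : R3 × R3) →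
          LocallyExtends G (g ∘ Φ.symm) (Φ x : R3 × R3) →
            B.redBracket f g x = B.rankBracket B.A.rank F G (Φ x) := by
  obtain ⟨a, b, h, hj⟩ := Body.exists_isCoupled hI hm hA
  obtain ⟨Φ, hΦ⟩ := h.exists_equiv hI hm hA
  refine ⟨fun f hf z => h.existsUnique_isHamVec hI hm hf z,
    fun s hs z hz => Body.cotangentLift_mem hI hA hs hz,
    fun f g hf hg => ⟨h.smoothRed_redBracket hI hm hΦ hj hf hg, fun z => ?_⟩,
    B.rankBracket_casimir B.A.rank, Φ, fun z => by rw [hΦ]; rfl, h.smoothRed_iff hI hm hΦ,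
    fun f g _ _ x F G hF hG => h.redBracket_eq hI hm hΦ hj hF hG⟩
  -- Both brackets are compared through the explicit one, for which some local extensions are
  -- needed.
  obtain ⟨F, hF⟩ := h.smoothFun_comp_symm hI hm hΦ hf (Φ (B.orbitProj z))
  obtain ⟨G, hG⟩ := h.smoothFun_comp_symm hI hm hΦ hg (Φ (B.orbitProj z))
  rw [h.redBracket_eq hI hm hΦ hj hF hG, h.nhBracket_orbitProj hI hm hΦ hj hF hG]
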